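/- For integers $1\le k\le n$ let $L_k(n)\subseteq[n]^k$ be the set of words of length $k$ over $[n]$ whose symbols are all distinct. An NFA $M$ over the alphabet $[n]$ has one start state, a set of accepting states, and transitions each labelled by one symbol of $[n]$; its size is the number of its states plus the number of its transitions, and it is acyclic if it has no directed cycle. In the problem MIN-WT SIMPLE $(s,t)$-$k$-PATH one is given a directed graph $G$ on $[n]$ with integer edge weights (as adjacency and weight matrices), vertices $s,t$ and the number $k$, and has to determine whether $G$ has a simple path with exactly $k$ vertices that begins in $s$ and ends in $t$, and if so, to return such a path of minimal weight. Running times refer to a random access machine with words of $w$ bits, where $w$ is at least the number of binary digits of $\mathrm{size}(M)$; operations on numbers of $O(w)$ bits take constant time, and longer numbers are charged for the number of words that they occupy (multiplication and division as in the schoolbook method). Let $P$ be a program that is given $n$ and $k$. (1) There is a program $A$ such that for every constant $C$ there is a constant $D$ with the following property. For all integers $1\le k\le n$, if $P$ on input $(n,k)$ constructs, in time at most $C\cdot\sigma$, an NFA $M$ of size $\sigma$ with $L(M)=L_k(n)$, then $A$ solves MIN-WT SIMPLE $(s,t)$-$k$-PATH on all graphs with $n$ vertices and non-negative integer weights of size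 at most $W$ $(W\ge 2)$ in time at most $D\cdot \sigma\cdot\log \sigma\cdot n^2\cdot\log W$. (2) There is a program $A$ such that for every constant $C$ there is a constant $D$ with the following property. For all integers $1\le k\le n$, if $P$ on input $(n,k)$ constructs, in time at most $C\cdot\sigma$, an acyclic NFA $M$ of size $\sigma$ with $L(M)=L_k(n)$, then $A$ solves MIN-WT SIMPLE $(s,t)$-$k$-PATH on all graphs with $n$ vertices and integer weights in the range $[-W,W]$ $(W\ge 2)$ in time at most $D\cdot \sigma\cdot n^2\cdot\log W$. -/

import Mathlib

/-! ## A random access machine with words of `w` bits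

The machine has registers and memory banks (arrays), all holding integers.  An integer occupies as
many words of `w` bits as its binary expansion needs, and an instruction is charged for the words
that it handles: the operations on numbers of `O(w)` bits (in particular on indices and addresses)
take constant time, whereas long numbers are charged for their length. -/

namespace WordRAM

/-- The number of words of `w` bits that are occupied by the integer `x`, up to rounding. -/
def len (w : ℕ) (x : ℤ) : ℕ := Nat.size x.natAbs / w + 1

/-- Contents of the registers, `reg r`, and of the memory banks, `mem b a` (bank, address). -/
structure Store where
  reg : ℕ → ℤ
  mem : ℕ → ℤ → ℤ

/-- `σ` with the value `x` written into the register `r`. -/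
def Store.setReg (σ : Store) (r : ℕ) (x : ℤ) : Store :=
  { σ with reg := Function.update σ.reg r x }

/-- `σ` with the value `x` written into the cell `a` of the bank `b`. -/
def Store.setMem (σ : Store) (b : ℕ) (a x : ℤ) : Store :=
  { σ with mem := Function.update σ.mem b (Function.update (σ.mem b) a x) }

/-- The operations of the arithmetic unit. -/
inductive Op where
  | add | sub | mul | div | and | or | xor | shl | shr

/-- The value of an operation (`div` is integer division, with value `0` for the divisor `0`). -/
def Op.eval : Op → ℤ → ℤ → ℤ
  | add, x, y => x + y
  | sub, x, y => x - y
  | mul, x, y => x * y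
  | div, x, y => x / y
  | and, x, y => Int.land x y
  | or, x, y => Int.lor x y
  | xor, x, y => Int.xor x y
  | shl, x, y => x * 2 ^ y.toNat
  | shr, x, y => x / 2 ^ y.toNat

/-- The cost of an operation: linear in the number of words of the operands and the result,
except for multiplication and division, which are charged as in the schoolbook method. -/
def Op.cost (w : ℕ) (op : Op) (x y : ℤ) : ℕ :=
  match op with
  | mul => len w x * len w y
  | div => len w x * len w y
  | _ => len w x + len w y + len w (op.eval x y)

/-- Programs. -/
inductive Cmd where
  /-- do nothing -/
  | skip
  /-- `r := c` -/
  | const (r : ℕ) (c : ℤ)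
  /-- `r := x op y`, for registers `x` and `y` -/
  | arith (op : Op) (r x y : ℕ)
  /-- `r := b[a]`, for a bank `b` and a register `a` that holds the address -/
  | load (r b a : ℕ)
  /-- `b[a] := r`, for a bank `b` and a register `a` that holds the address -/
  | store (b a r : ℕ)
  /-- `c; d` -/
  | seq (c d : Cmd)
  /-- if the register `r` is positive then `c` else `d` -/
  | branch (r : ℕ) (c d : Cmd)
  /-- while the register `r` is positive do `c` -/
  | loop (r : ℕ) (c : Cmd)

/-- `Exec w c σ τ t`: on a machine with words of `w` bits, the program `c` started in `σ` halts
in `τ`, after exactly `t` time units. -/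
inductive Exec (w : ℕ) : Cmd → Store → Store → ℕ → Prop where
  | skip (σ : Store) : Exec w Cmd.skip σ σ 1
  | const (σ : Store) (r : ℕ) (c : ℤ) :
      Exec w (Cmd.const r c) σ (σ.setReg r c) (len w c)
  | arith (σ : Store) (op : Op) (r x y : ℕ) :
      Exec w (Cmd.arith op r x y) σ (σ.setReg r (op.eval (σ.reg x) (σ.reg y)))
        (op.cost w (σ.reg x) (σ.reg y))
  | load (σ : Store) (r b a : ℕ) :
      Exec w (Cmd.load r b a) σ (σ.setReg r (σ.mem b (σ.reg a)))
        (len w (σ.reg a) + len w (σ.mem b (σ.reg a)))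
  | store (σ : Store) (b a r : ℕ) :
      Exec w (Cmd.store b a r) σ (σ.setMem b (σ.reg a) (σ.reg r))
        (len w (σ.reg a) + len w (σ.reg r))
  | seq {c d : Cmd} {σ τ υ : Store} {t t' : ℕ} (h : Exec w c σ τ t) (h' : Exec w d τ υ t') :
      Exec w (Cmd.seq c d) σ υ (t + t')
  | branch_pos {r : ℕ} {c d : Cmd} {σ τ : Store} {t : ℕ} (hr : 0 < σ.reg r)
      (h : Exec w c σ τ t) : Exec w (Cmd.branch r c d) σ τ (len w (σ.reg r) + t)
  | branch_nonpos {r : ℕ} {c d : Cmd} {σ τ : Store} {t : ℕ} (hr : σ.reg r ≤ 0)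
      (h : Exec w d σ τ t) : Exec w (Cmd.branch r c d) σ τ (len w (σ.reg r) + t)
  | loop_pos {r : ℕ} {c : Cmd} {σ τ υ : Store} {t t' : ℕ} (hr : 0 < σ.reg r)
      (h : Exec w c σ τ t) (h' : Exec w (Cmd.loop r c) τ υ t') :
      Exec w (Cmd.loop r c) σ υ (len w (σ.reg r) + t + t')
  | loop_nonpos {r : ℕ} {c : Cmd} {σ : Store} (hr : σ.reg r ≤ 0) :
      Exec w (Cmd.loop r c) σ σ (len w (σ.reg r))

end WordRAM

/-! ## Automata -/

namespace KPath

open WordRAM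

/-- `L_k(n)`: the words of length `k` over `[n]` whose symbols are all distinct. -/
def distinctWords (n k : ℕ) : Language (Fin n) :=
  {x : List (Fin n) | x.length = k ∧ x.Nodup}

/-- The transitions (source, label, target) of an automaton. -/
def transitions {α σ : Type*} (M : NFA α σ) : Set (σ × α × σ) :=
  {e | e.2.2 ∈ M.step e.1 e.2.1}

/-- The size of an automaton: the number of states plus the number of transitions. -/
noncomputable def autSize {α σ : Type*} (M : NFA α σ) : ℕ :=
  Nat.card σ + (transitions M).ncard

/-- The automaton has no directed cycle (loops included). -/
def IsAcyclic {α σ : Type*} (M : NFA α σ) : Prop :=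
  ∀ q, ¬ Relation.TransGen (fun p r => ∃ a, r ∈ M.step p a) q q

open Classical in
/-- The store holds the automaton `M`, which has a single start state: registers 0, 1, 2 hold the
number of states, the number of transitions and the start state; banks 0, 1, 2 list the sources,
the labels and the targets of the transitions, each transition once, in any order; bank 3 marks the
accepting states. -/
def Holds {n m : ℕ} (τ : Store) (M : NFA (Fin n) (Fin m)) : Prop :=
  ∃ (q₀ : Fin m) (d : ℕ) (e : Fin d ≃ transitions M),
    M.start = {q₀} ∧
    τ.reg 0 = m ∧ τ.reg 1 = d ∧ τ.reg 2 = (q₀ : ℕ) ∧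
    (∀ i : Fin d,
      τ.mem 0 (i : ℕ) = ((e i).1.1 : ℕ) ∧
      τ.mem 1 (i : ℕ) = ((e i).1.2.1 : ℕ) ∧
      τ.mem 2 (i : ℕ) = ((e i).1.2.2 : ℕ)) ∧
    ∀ q : Fin m, τ.mem 3 (q : ℕ) = if q ∈ M.accept then 1 else 0

/-- The input `(n, k)`: in the registers 0 and 1, everything else being 0. -/
def paramInput (n k : ℕ) : Store where
  reg i := match i with
    | 0 => n
    | 1 => k
    | _ => 0
  mem _ _ := 0

/-- With words of `w` bits and input `(n, k)`, the program `P` constructs `M` in time at most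
`T`. -/
def ConstructsWithin {n m : ℕ} (w : ℕ) (P : Cmd) (k : ℕ) (M : NFA (Fin n) (Fin m)) (T : ℝ) :
    Prop :=
  ∃ (τ : Store) (t : ℕ), Exec w P (paramInput n k) τ t ∧ Holds τ M ∧ (t : ℝ) ≤ T

/-! ## Paths -/

/-- `p = v₁ → … → v_k` is a simple path with `k` vertices in `G` from `a` to `b`. -/
def IsSimplePath {V : Type*} (G : Digraph V) (k : ℕ) (a b : V) (p : List V) : Prop :=
  p.length = k ∧ p.Nodup ∧ p.IsChain G.Adj ∧ p.head? = some a ∧ p.getLast? = some b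

/-- The sum of the weights of the edges of a path. -/
def pathWeight {V : Type*} (wt : V → V → ℤ) : List V → ℤ
  | u :: v :: p => wt u v + pathWeight wt (v :: p)
  | _ => 0

/-- `p` is a simple path with `k` vertices from `a` to `b`, of minimal weight among these. -/
def IsMinSimplePath {V : Type*} (G : Digraph V) (wt : V → V → ℤ) (k : ℕ) (a b : V)
    (p : List V) : Prop :=
  IsSimplePath G k a b p ∧ ∀ p', IsSimplePath G k a b p' → pathWeight wt p ≤ pathWeight wt p'

open Classical in
/-- The input of the path problem: `n`, `k` and the vertices `a`, `b` in the registers 0 to 3, the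
adjacency matrix in bank 0 and the weights of the edges in bank 1, both row by row, everything else
being 0. -/
noncomputable def pathInput {n : ℕ} (G : Digraph (Fin n)) (wt : Fin n → Fin n → ℤ) (k : ℕ)
    (a b : Fin n) : Store where
  reg i := match i with
    | 0 => n
    | 1 => k
    | 2 => (a : ℕ)
    | 3 => (b : ℕ)
    | _ => 0
  mem i x := match i with
    | 0 => ∑ u : Fin n, ∑ v : Fin n,
        if x = (u : ℕ) * (n : ℤ) + (v : ℕ) ∧ G.Adj u v then 1 else 0
    | 1 => ∑ u : Fin n, ∑ v : Fin n,
        if x = (u : ℕ) * (n : ℤ) + (v : ℕ) ∧ G.Adj u v then wt u v else 0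
    | _ => 0

/-- The store holds a correct answer to the path problem: register 0 says whether a path exists,
and if so, bank 0 lists the vertices of one of minimal weight. -/
def IsAnswer {n : ℕ} (G : Digraph (Fin n)) (wt : Fin n → Fin n → ℤ) (k : ℕ) (a b : Fin n)
    (τ : Store) : Prop :=
  (τ.reg 0 = 1 ∧ ∃ p : List (Fin n), IsMinSimplePath G wt k a b p ∧
      ∀ i : Fin p.length, τ.mem 0 (i : ℕ) = (p.get i : ℕ)) ∨
    (τ.reg 0 = 0 ∧ ¬ ∃ p, IsSimplePath G k a b p)

/-- With words of `w` bits, the program `A` solves the instance of the path problem in time at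
most `T`. -/
def SolvesWithin {n : ℕ} (w : ℕ) (A : Cmd) (G : Digraph (Fin n)) (wt : Fin n → Fin n → ℤ)
    (k : ℕ) (a b : Fin n) (T : ℝ) : Prop :=
  ∃ (τ : Store) (t : ℕ), Exec w A (pathInput G wt k a b) τ t ∧ IsAnswer G wt k a b τ ∧
    (t : ℝ) ≤ T

end KPath

/-
Multiply the automaton by the graph: a node is a pair of a state and a vertex, and a step reads the
vertex and follows an edge.  As `L(M) = L_k(n)`, the walks with `k - 1` steps that start in `s` and
whose last vertex `t` leads into an accepting state are, on the graph side, exactly the simple paths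
with `k` vertices from `s` to `t`.  With the number of steps as a third coordinate the product is
acyclic, so dynamic programming finds a cheapest walk for weights of any sign.  It relaxes
`(k - 1) * |δ| * n` steps, each with a bounded number of instructions on integers that occupy
`O(1 + log W)` words.
-/

namespace WordRAM

namespace Store

@[simp] lemma reg_setReg (σ : Store) (r : ℕ) (x : ℤ) (r' : ℕ) :
    (σ.setReg r x).reg r' = if r' = r then x else σ.reg r' := by
  simp [setReg, Function.update_apply]

@[simp] lemma mem_setReg (σ : Store) (r : ℕ) (x : ℤ) : (σ.setReg r x).mem = σ.mem := rfl

@[simp] lemma reg_setMem (σ : Store) (b : ℕ) (a x : ℤ) : (σ.setMem b a x).reg = σ.reg := rfl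

@[simp] lemma mem_setMem (σ : Store) (b : ℕ) (a x : ℤ) (b' : ℕ) :
    (σ.setMem b a x).mem b' = if b' = b then Function.update (σ.mem b) a x else σ.mem b' := by
  simp [setMem, Function.update_apply]

lemma setReg_setReg (σ : Store) (r : ℕ) (x y : ℤ) : (σ.setReg r x).setReg r y = σ.setReg r y := by
  simp [setReg]

/-- The stores `σ` and `τ` agree except on the registers in `R` and the banks in `B`: the frame of
a program that only writes there. -/
structure AgreeOff (R B : Set ℕ) (σ τ : Store) : Prop where
  reg : ∀ r ∉ R, τ.reg r = σ.reg r
  mem : ∀ b ∉ B, τ.mem b = σ.mem b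

namespace AgreeOff

variable {R R' B B' : Set ℕ} {σ τ υ : Store}

lemma refl (R B : Set ℕ) (σ : Store) : σ.AgreeOff R B σ := ⟨fun _ _ => rfl, fun _ _ => rfl⟩

lemma trans (h : σ.AgreeOff R B τ) (h' : τ.AgreeOff R B υ) : σ.AgreeOff R B υ :=
  ⟨fun r hr => (h'.reg r hr).trans (h.reg r hr), fun b hb => (h'.mem b hb).trans (h.mem b hb)⟩

lemma mono (h : σ.AgreeOff R B τ) (hR : R ⊆ R') (hB : B ⊆ B') : σ.AgreeOff R' B' τ :=
  ⟨fun r hr => h.reg r fun hr' => hr (hR hr'), fun b hb => h.mem b fun hb' => hb (hB hb')⟩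

lemma setReg (h : σ.AgreeOff R B τ) {r : ℕ} (hr : r ∈ R) (x : ℤ) :
    σ.AgreeOff R B (τ.setReg r x) :=
  h.trans ⟨fun r' hr' => by rw [reg_setReg, if_neg (ne_of_mem_of_not_mem hr hr').symm],
    fun _ _ => rfl⟩

lemma setMem (h : σ.AgreeOff R B τ) {b : ℕ} (hb : b ∈ B) (a x : ℤ) :
    σ.AgreeOff R B (τ.setMem b a x) :=
  h.trans ⟨fun _ _ => rfl,
    fun b' hb' => by rw [mem_setMem, if_neg (ne_of_mem_of_not_mem hb hb').symm]⟩

end AgreeOff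

/-- The part of the store that a program shifted by `R` and `B` can access. -/
def view (R B : ℕ) (σ : Store) : Store where
  reg r := σ.reg (r + R)
  mem b := σ.mem (b + B)

lemma view_setReg (R B : ℕ) (σ : Store) (r : ℕ) (x : ℤ) :
    (σ.setReg (r + R) x).view R B = (σ.view R B).setReg r x := by
  simp only [view, setReg, mk.injEq, and_true]
  funext r'
  simp [Function.update_apply]

lemma view_setMem (R B : ℕ) (σ : Store) (b : ℕ) (a x : ℤ) :
    (σ.setMem (b + B) a x).view R B = (σ.view R B).setMem b a x := by
  simp only [view, setMem, mk.injEq, true_and]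
  funext b'
  simp [Function.update_apply]

end Store

/-- The program with all registers shifted by `R` and all banks shifted by `B`, which makes room for
the data of a surrounding program. -/
def Cmd.shift (R B : ℕ) : Cmd → Cmd
  | .skip => .skip
  | .const r c => .const (r + R) c
  | .arith op r x y => .arith op (r + R) (x + R) (y + R)
  | .load r b a => .load (r + R) (b + B) (a + R)
  | .store b a r => .store (b + B) (a + R) (r + R)
  | .seq c d => .seq (c.shift R B) (d.shift R B)
  | .branch r c d => .branch (r + R) (c.shift R B) (d.shift R B)
  | .loop r c => .loop (r + R) (c.shift R B)

lemma Exec.shift {w : ℕ} (R B : ℕ) {c : Cmd} {σ τ : Store} {t : ℕ} (h : Exec w c σ τ t) :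
    ∀ σ' : Store, σ'.view R B = σ → ∃ τ', Exec w (c.shift R B) σ' τ' t ∧ τ'.view R B = τ ∧
      σ'.AgreeOff (Set.Ici R) (Set.Ici B) τ' := by
  have hreg {σ : Store} (r : ℕ) (x : ℤ) :
      σ.AgreeOff (Set.Ici R) (Set.Ici B) (σ.setReg (r + R) x) :=
    (Store.AgreeOff.refl ..).setReg (by simp) x
  induction h with
  | skip σ => exact fun σ' h => ⟨σ', .skip _, h, .refl ..⟩
  | const => rintro σ' rfl; exact ⟨_, .const .., Store.view_setReg .., hreg ..⟩
  | arith => rintro σ' rfl; exact ⟨_, .arith .., Store.view_setReg .., hreg ..⟩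
  | load => rintro σ' rfl; exact ⟨_, .load .., Store.view_setReg .., hreg ..⟩
  | store =>
    rintro σ' rfl
    exact ⟨_, .store .., Store.view_setMem .., (Store.AgreeOff.refl ..).setMem (by simp) ..⟩
  | seq _ _ ih ih' =>
    intro σ' h
    obtain ⟨τ', e, v, s⟩ := ih σ' h
    obtain ⟨υ', e', v', s'⟩ := ih' τ' v
    exact ⟨υ', .seq e e', v', s.trans s'⟩
  | branch_pos hr _ ih =>
    rintro σ' rfl
    obtain ⟨τ', e, v, s⟩ := ih σ' rfl
    exact ⟨τ', .branch_pos hr e, v, s⟩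
  | branch_nonpos hr _ ih =>
    rintro σ' rfl
    obtain ⟨τ', e, v, s⟩ := ih σ' rfl
    exact ⟨τ', .branch_nonpos hr e, v, s⟩
  | loop_pos hr _ _ ih ih' =>
    rintro σ' rfl
    obtain ⟨τ', e, v, s⟩ := ih σ' rfl
    obtain ⟨υ', e', v', s'⟩ := ih' τ' v
    exact ⟨υ', .loop_pos hr e e', v', s.trans s'⟩
  | loop_nonpos hr =>
    rintro σ' rfl
    exact ⟨σ', .loop_nonpos hr, rfl, .refl ..⟩

lemma len_le {w : ℕ} (hw : 1 ≤ w) (c s : ℕ) {x : ℤ} (hx : x.natAbs < 2 ^ (c * w + s)) :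
    len w x ≤ c + s + 1 := by
  have hsize : Nat.size x.natAbs ≤ c * w + s := Nat.size_le.2 hx
  have hdiv : Nat.size x.natAbs / w ≤ c + s := Nat.div_le_of_le_mul (by nlinarith)
  unfold len
  omega

/-- The integer `x` is so short that every instruction that handles at most three such integers,
multiplication and division excepted, takes time at most `K`. -/
def Fits (w K : ℕ) (x : ℤ) : Prop := 3 * len w x ≤ K

lemma Fits.len_le {w K : ℕ} {x : ℤ} (h : Fits w K x) : len w x ≤ K :=
  (Nat.le_mul_of_pos_left _ three_pos).trans h

lemma Fits.mono {w K x y : ℕ} (h : Fits w K y) (hxy : x ≤ y) : Fits w K x := by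
  unfold Fits len at *
  have := Nat.div_le_div_right (c := w) (Nat.size_le_size hxy)
  simp only [Int.natAbs_natCast] at *
  omega

/-- Call `c` once for each `i < N`, in decreasing order, where `N` is the value of the register `x`:
the register `r` holds `i`, and the registers `r₀` and `r₁` hold the constants 0 and 1. -/
def Cmd.forDown (r₀ r₁ r x : ℕ) (c : Cmd) : Cmd :=
  .seq (.arith .add r x r₀) (.loop r (.seq (.arith .sub r r r₁) c))

/-- Started in `σ`, the program `c` halts in a store that satisfies `Q`, within `T` rounds of `K`
time units each. -/
def Within (w K : ℕ) (c : Cmd) (σ : Store) (T : ℕ) (Q : Store → Prop) : Prop :=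
  ∃ τ t, Exec w c σ τ t ∧ t ≤ T * K ∧ Q τ

namespace Within

variable {w K : ℕ} {c d : Cmd} {σ : Store} {T T' : ℕ} {Q Q' : Store → Prop} {r x y b : ℕ}
  {u v : ℤ}

lemma mono (h : Within w K c σ T Q) (hT : T ≤ T') (hQ : ∀ τ, Q τ → Q' τ) :
    Within w K c σ T' Q' :=
  let ⟨τ, t, e, ht, q⟩ := h
  ⟨τ, t, e, ht.trans (Nat.mul_le_mul_right K hT), hQ τ q⟩

lemma of_le (h : Within w K c σ T Q) (hT : T ≤ T') : Within w K c σ T' Q :=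
  h.mono hT fun _ => id

lemma imp (h : Within w K c σ T Q) (hQ : ∀ τ, Q τ → Q' τ) : Within w K c σ T Q' :=
  h.mono le_rfl hQ

lemma seq (h : Within w K c σ T' fun τ => Within w K d τ (T - T') Q)
    (hT : T' ≤ T := by omega) : Within w K (.seq c d) σ T Q :=
  let ⟨_, _, e, ht, υ, _, e', ht', q⟩ := h
  ⟨υ, _, .seq e e', (add_le_add ht ht').trans_eq (by rw [← add_mul, Nat.add_sub_cancel' hT]), q⟩

lemma skip (hK : 1 ≤ K) (h : Q σ) : Within w K .skip σ 1 Q :=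
  ⟨σ, 1, .skip σ, by rwa [one_mul], h⟩

lemma const (hv : Fits w K v) (h : Q (σ.setReg r v)) : Within w K (.const r v) σ 1 Q :=
  ⟨_, _, .const .., by rw [one_mul]; exact hv.len_le, h⟩

lemma add (hx : σ.reg x = u) (hy : σ.reg y = v) (hu : Fits w K u) (hv : Fits w K v)
    (huv : Fits w K (u + v)) (h : Q (σ.setReg r (u + v))) :
    Within w K (.arith .add r x y) σ 1 Q := by
  subst hx hy
  exact ⟨_, _, .arith .., by unfold Fits at *; simp only [Op.cost, Op.eval]; omega, h⟩

lemma sub (hx : σ.reg x = u) (hy : σ.reg y = v) (hu : Fits w K u) (hv : Fits w K v)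
    (huv : Fits w K (u - v)) (h : Q (σ.setReg r (u - v))) :
    Within w K (.arith .sub r x y) σ 1 Q := by
  subst hx hy
  exact ⟨_, _, .arith .., by unfold Fits at *; simp only [Op.cost, Op.eval]; omega, h⟩

lemma mul (hx : σ.reg x = u) (hy : σ.reg y = v) (huv : len w u * len w v ≤ K)
    (h : Q (σ.setReg r (u * v))) : Within w K (.arith .mul r x y) σ 1 Q := by
  subst hx hy
  exact ⟨_, _, .arith .., by rwa [one_mul], h⟩

lemma load (hx : σ.reg x = u) (hv : σ.mem b u = v) (hu : Fits w K u) (hv' : Fits w K v)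
    (h : Q (σ.setReg r v)) : Within w K (.load r b x) σ 1 Q := by
  subst hx hv
  exact ⟨_, _, .load .., by unfold Fits at *; omega, h⟩

lemma store (hx : σ.reg x = u) (hr : σ.reg r = v) (hu : Fits w K u) (hv : Fits w K v)
    (h : Q (σ.setMem b u v)) : Within w K (.store b x r) σ 1 Q := by
  subst hx hr
  exact ⟨_, _, .store .., by unfold Fits at *; omega, h⟩

lemma branch (hr : σ.reg r = v) (hv : Fits w K v) (h : 0 < v → Within w K c σ T Q)
    (h' : v ≤ 0 → Within w K d σ T Q) : Within w K (.branch r c d) σ (1 + T) Q := by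
  subst hr
  have hlen := hv.len_le
  rcases lt_or_ge 0 (σ.reg r) with hp | hp
  · obtain ⟨τ, t, e, ht, q⟩ := h hp
    exact ⟨τ, _, .branch_pos hp e, by rw [add_mul]; omega, q⟩
  · obtain ⟨τ, t, e, ht, q⟩ := h' hp
    exact ⟨τ, _, .branch_nonpos hp e, by rw [add_mul]; omega, q⟩

lemma loop_zero (hr : σ.reg r = (0 : ℕ)) (hfit : Fits w K (0 : ℕ)) (h : Q σ) :
    Within w K (.loop r c) σ 1 Q :=
  ⟨σ, _, .loop_nonpos hr.le, by rw [hr, one_mul]; exact hfit.len_le, h⟩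

lemma loop_succ {r₁ N : ℕ} (hr : σ.reg r = (N + 1 : ℕ)) (hone : σ.reg r₁ = 1)
    (hN : ∀ i ≤ N + 1, Fits w K (i : ℤ))
    (h : Within w K c (σ.setReg r N) T'
      fun τ => Within w K (.loop r (.seq (.arith .sub r r r₁) c)) τ (T - (T' + 2)) Q)
    (hT : T' + 2 ≤ T) : Within w K (.loop r (.seq (.arith .sub r r r₁) c)) σ T Q := by
  have hlen := (hN _ le_rfl).len_le
  have hsub : ((N + 1 : ℕ) : ℤ) - 1 = N := by push_cast; ring
  obtain ⟨τ, t, e, ht, υ, t', e', ht', q⟩ := (sub (Q := fun τ => Within w K c τ T' _) hr hone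
    (hN _ le_rfl) (by exact_mod_cast hN 1 (by omega)) (hsub ▸ hN N N.le_succ) (hsub ▸ h)).seq
    (T := T' + 1)
  refine ⟨υ, _, .loop_pos (by rw [hr]; positivity) e e', ?_, q⟩
  obtain ⟨R, rfl⟩ := Nat.exists_eq_add_of_le hT
  rw [Nat.add_sub_cancel_left] at ht'
  rw [hr]
  calc _ ≤ K + (T' + 1) * K + R * K := by omega
    _ = _ := by ring

section forDown

variable {β : Type*} {I : β → Store → Prop} {r₀ r₁ : ℕ}

lemma countdown (hset : ∀ s τ z, I s τ → I s (τ.setReg r z)) (hone : ∀ s τ, I s τ → τ.reg r₁ = 1)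
    {N : ℕ} (hN : ∀ i ≤ N, Fits w K (i : ℤ)) {f : Fin N → β → β}
    (hbody : ∀ (i : Fin N) s τ, I s τ → τ.reg r = (i : ℕ) →
      Within w K c τ T fun υ => I (f i s) υ ∧ υ.reg r = (i : ℕ))
    {s : β} (hs : I s σ) (hr : σ.reg r = N) :
    Within w K (.loop r (.seq (.arith .sub r r r₁) c)) σ ((N + 1) * (T + 2))
      (I (Fin.foldr N f s)) := by
  induction N generalizing s σ with
  | zero =>
    rw [Fin.foldr_zero]
    exact (loop_zero hr (hN 0 le_rfl) hs).of_le (by omega)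
  | succ N ih =>
    refine loop_succ hr (hone s σ hs) hN (T' := T) ?_ (by nlinarith)
    refine (hbody (Fin.last N) s _ (hset s σ _ hs) (by simp)).imp fun τ ⟨hτ, hτr⟩ => ?_
    rw [Fin.foldr_succ_last]
    exact (ih (fun i hi => hN i (by omega)) (fun i => hbody i.castSucc) hτ hτr).mono
      (by rw [add_one_mul (N + 1)]; omega) fun _ h => h

lemma forDown (hset : ∀ s τ z, I s τ → I s (τ.setReg r z)) (hone : ∀ s τ, I s τ → τ.reg r₁ = 1)
    {N : ℕ} (hN : ∀ i ≤ N, Fits w K (i : ℤ)) {f : Fin N → β → β}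
    (hbody : ∀ (i : Fin N) s τ, I s τ → τ.reg r = (i : ℕ) →
      Within w K c τ T fun υ => I (f i s) υ ∧ υ.reg r = (i : ℕ))
    {s : β} (hs : I s σ) (hzero : σ.reg r₀ = 0) (hx : σ.reg x = N) :
    Within w K (.forDown r₀ r₁ r x c) σ (1 + (N + 1) * (T + 2)) (I (Fin.foldr N f s)) := by
  refine (add hx hzero (hN N le_rfl) (hN 0 N.zero_le) ?_ ?_).seq
  · simpa using hN N le_rfl
  · exact (countdown hset hone hN hbody (hset s σ _ hs) (by simp)).of_le (by omega)

end forDown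

end Within

end WordRAM

namespace KPath

open WordRAM

section Fold

variable {β : Type*}

lemma foldr_induction {p : β → Prop} : ∀ {N : ℕ} {f : Fin N → β → β} {s : β},
    (∀ i s, p s → p (f i s)) → p s → p (Fin.foldr N f s)
  | 0, _, _, _, hs => by rwa [Fin.foldr_zero]
  | _ + 1, _, _, h, hs => by
    rw [Fin.foldr_succ]
    exact h 0 _ (foldr_induction (fun i => h i.succ) hs)

lemma foldr_forall {N : ℕ} {f : Fin N → β → β} {R : Fin N → β → Prop}
    (hself : ∀ i s, R i (f i s)) (hkeep : ∀ i j s, R i s → R i (f j s)) (s : β) (i : Fin N) :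
    R i (Fin.foldr N f s) := by
  induction N generalizing s with
  | zero => exact i.elim0
  | succ N ih =>
    rw [Fin.foldr_succ]
    cases i using Fin.cases with
    | zero => exact hself 0 _
    | succ i => exact hkeep _ _ _ (ih (fun i => hself i.succ) (fun i j => hkeep i.succ j.succ) s i)

end Fold

section Table

/-- A table for cheapest walks with a prescribed number of steps in a graph on `ι`: `dist (r, x)` is
an upper bound for the cost of a walk with `r` steps that starts in `x`, where `⊤` means that no
such walk is known, and `next (r, x)` is the second node of a walk that attains this bound. -/
structure Table (ι R : Type*) where
  dist : ℕ × ι → R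
  next : ℕ × ι → ι

variable {ι R : Type*}

/-- The cost of the walk `x :: l`, where `c` is the cost of a step and `g` the cost of stopping. -/
def walkCost [Add R] (c : ι → ι → R) (g : ι → R) : ι → List ι → R
  | x, [] => g x
  | x, y :: l => c x y + walkCost c g y l

namespace Table

/-- The walk of `r` steps from `x` that is recorded in the table, without its first node. -/
def trace (T : Table ι R) : ℕ → ι → List ι
  | 0, _ => []
  | r + 1, x => T.next (r + 1, x) :: T.trace r (T.next (r + 1, x))

/-- The table without any bounds; its successors are arbitrary. -/
def empty [Top R] : Table ι R := ⟨fun _ => ⊤, Prod.snd⟩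

variable [LinearOrder R]

section Lower

variable [DecidableEq ι]

/-- Replace the bound for the node `x` by `d`, with successor `y`, if this is an improvement. -/
def lower (T : Table ι R) (x : ℕ × ι) (d : R) (y : ι) : Table ι R :=
  if d < T.dist x then ⟨Function.update T.dist x d, Function.update T.next x y⟩ else T

variable {T : Table ι R} {x : ℕ × ι} {d : R} {y : ι}

lemma dist_lower : (T.lower x d y).dist = Function.update T.dist x (min d (T.dist x)) := by
  unfold lower
  split_ifs with h
  · rw [min_eq_left h.le]
  · rw [min_eq_right (not_lt.1 h), Function.update_eq_self]

lemma dist_lower_le (z : ℕ × ι) : (T.lower x d y).dist z ≤ T.dist z := by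
  rw [dist_lower, Function.update_apply]
  split_ifs with h
  · exact h ▸ min_le_right _ _
  · exact le_rfl

lemma dist_lower_self_le : (T.lower x d y).dist x ≤ d := by
  rw [dist_lower, Function.update_self]
  exact min_le_left _ _

lemma dist_lower_of_ne {z : ℕ × ι} (h : z ≠ x) : (T.lower x d y).dist z = T.dist z := by
  rw [dist_lower, Function.update_of_ne h]

end Lower

section IsSound

variable [Add R] {c : ι → ι → R} {g : ι → R}

/-- Every bound in the table is justified by a walk through the recorded successor. -/
structure IsSound (c : ι → ι → R) (g : ι → R) (T : Table ι R) : Prop where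
  stop_le : ∀ x, g x ≤ T.dist (0, x)
  step_le : ∀ r x, c x (T.next (r + 1, x)) + T.dist (r, T.next (r + 1, x)) ≤ T.dist (r + 1, x)

/-- The table holds the costs of the cheapest walks with at most `L` steps. -/
structure IsExact (c : ι → ι → R) (g : ι → R) (L : ℕ) (T : Table ι R) : Prop
    extends IsSound c g T where
  dist_le_stopping : ∀ x, T.dist (0, x) ≤ g x
  dist_le_step : ∀ r < L, ∀ x y, T.dist (r + 1, x) ≤ c x y + T.dist (r, y)

lemma isSound_empty [OrderTop R] : IsSound c g empty := ⟨fun _ => le_top, fun _ _ => le_top⟩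

section AddLeftMono

variable [AddLeftMono R] {T : Table ι R}

lemma IsExact.dist_le_walkCost {L : ℕ} (h : T.IsExact c g L) (x : ι) (l : List ι)
    (hl : l.length ≤ L) : T.dist (l.length, x) ≤ walkCost c g x l := by
  induction l generalizing x with
  | nil => exact h.dist_le_stopping x
  | cons y l ih =>
    exact (h.dist_le_step l.length hl x y).trans
      (add_le_add_right (ih y (Nat.le_of_succ_le hl)) _)

lemma IsSound.walkCost_trace_le (h : T.IsSound c g) (r : ℕ) (x : ι) :
    walkCost c g x (T.trace r x) ≤ T.dist (r, x) := by
  induction r generalizing x with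
  | zero => exact h.stop_le x
  | succ r ih => exact (add_le_add_right (ih _) _).trans (h.step_le r x)

variable [DecidableEq ι]

lemma IsSound.lower_zero (h : T.IsSound c g) {x : ι} {d : R} (hd : g x ≤ d) (y : ι) :
    (T.lower (0, x) d y).IsSound c g where
  stop_le z := by
    rw [dist_lower, Function.update_apply]
    split_ifs with hz
    · obtain rfl : z = x := by simpa using hz
      exact le_min hd (h.stop_le z)
    · exact h.stop_le z
  step_le r z := by
    have hnext : (T.lower (0, x) d y).next (r + 1, z) = T.next (r + 1, z) := by
      unfold lower
      split_ifs <;> simp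
    rw [hnext, dist_lower_of_ne (z := (r + 1, z)) (by simp)]
    exact (add_le_add_right (dist_lower_le _) _).trans (h.step_le r z)

lemma IsSound.lower_succ (h : T.IsSound c g) (r : ℕ) (x y : ι) :
    (T.lower (r + 1, x) (c x y + T.dist (r, y)) y).IsSound c g where
  stop_le z := (h.stop_le z).trans_eq (dist_lower_of_ne (by simp)).symm
  step_le s z := by
    refine (add_le_add_right (dist_lower_le _) _).trans ?_
    unfold lower
    split_ifs
    · by_cases hz : (s + 1, z) = (r + 1, x)
      · obtain ⟨rfl, rfl⟩ : s = r ∧ z = x := by simpa using hz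
        simp
      · simpa only [Function.update_of_ne hz] using h.step_le s z
    · exact h.step_le s z

end AddLeftMono

end IsSound

section Relax

/-- `T'` arises from `T` by improving bounds for walks with more than `r` steps. -/
structure LowersAbove (r : ℕ) (T T' : Table ι R) : Prop where
  dist_le : ∀ x, T'.dist x ≤ T.dist x
  dist_eq : ∀ s ≤ r, ∀ x, T'.dist (s, x) = T.dist (s, x)

lemma LowersAbove.refl (r : ℕ) (T : Table ι R) : T.LowersAbove r T := ⟨fun _ => le_rfl, by simp⟩

lemma LowersAbove.trans {r : ℕ} {T T' T'' : Table ι R} (h : T.LowersAbove r T')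
    (h' : T'.LowersAbove r T'') : T.LowersAbove r T'' :=
  ⟨fun x => (h'.dist_le x).trans (h.dist_le x),
    fun s hs x => (h'.dist_eq s hs x).trans (h.dist_eq s hs x)⟩

variable [DecidableEq ι]

lemma lowersAbove_lower (T : Table ι R) (r : ℕ) (x y : ι) (d : R) :
    T.LowersAbove r (T.lower (r + 1, x) d y) :=
  ⟨dist_lower_le, fun s hs z => dist_lower_of_ne (by simp; omega)⟩

variable [Add R]

/-- Improve the bound for walks with `r + 1` steps from `x` by walks whose second node is `y`. -/
def relax (c : ι → ι → R) (r : ℕ) (x y : ι) (T : Table ι R) : Table ι R :=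
  T.lower (r + 1, x) (c x y + T.dist (r, y)) y

/-- Improve the bounds for walks with `r + 1` steps by all steps `x i → y i j`. -/
def relaxLayer {d n : ℕ} (c : ι → ι → R) (x : Fin d → ι) (y : Fin d → Fin n → ι) (r : ℕ)
    (T : Table ι R) : Table ι R :=
  Fin.foldr d (fun i T => Fin.foldr n (fun j T => T.relax c r (x i) (y i j)) T) T

/-- Compute the bounds for walks with at most `L` steps `x i → y i j` from those with none.  The
layers are processed by a loop that counts down, hence `Fin.rev`. -/
def relaxLayers {d n : ℕ} (c : ι → ι → R) (x : Fin d → ι) (y : Fin d → Fin n → ι) (L : ℕ)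
    (T : Table ι R) : Table ι R :=
  Fin.foldr L (fun r T => T.relaxLayer c x y r.rev) T

variable {c : ι → ι → R} {g : ι → R} {d n : ℕ} {x : Fin d → ι} {y : Fin d → Fin n → ι}

lemma dist_relax_le (r : ℕ) (x y : ι) (T : Table ι R) :
    (T.relax c r x y).dist (r + 1, x) ≤ c x y + (T.relax c r x y).dist (r, y) := by
  have hy : (T.relax c r x y).dist (r, y) = T.dist (r, y) :=
    (lowersAbove_lower T r x y _).dist_eq r le_rfl y
  exact hy ▸ dist_lower_self_le

lemma lowersAbove_relaxLayer (r : ℕ) (T : Table ι R) :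
    T.LowersAbove r (T.relaxLayer c x y r) :=
  foldr_induction (p := T.LowersAbove r)
    (fun _ _ h => foldr_induction (fun _ T' h => h.trans (lowersAbove_lower T' r _ _ _)) h)
    (.refl r T)

lemma dist_relaxLayer_le (r : ℕ) (T : Table ι R) (i : Fin d) (j : Fin n) :
    (T.relaxLayer c x y r).dist (r + 1, x i) ≤
      c (x i) (y i j) + (T.relaxLayer c x y r).dist (r, y i j) := by
  have hkeep (i' i : Fin d) (j' j : Fin n) (T : Table ι R)
      (h : T.dist (r + 1, x i') ≤ c (x i') (y i' j') + T.dist (r, y i' j')) :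
      (T.relax c r (x i) (y i j)).dist (r + 1, x i') ≤
        c (x i') (y i' j') + (T.relax c r (x i) (y i j)).dist (r, y i' j') := by
    have hT := lowersAbove_lower T r (x i) (y i j) (c (x i) (y i j) + T.dist (r, y i j))
    exact (hT.dist_le _).trans (h.trans_eq (by rw [← hT.dist_eq r le_rfl]; rfl))
  exact foldr_forall (R := fun i (T : Table ι R) =>
      ∀ j, T.dist (r + 1, x i) ≤ c (x i) (y i j) + T.dist (r, y i j))
    (fun i T => foldr_forall (fun j T => dist_relax_le r _ _ T)
      (fun j' j T => hkeep i i j' j T) T)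
    (fun i' i T h j' => foldr_induction (fun j T => hkeep i' i j' j T) (h j')) T i j

section WithTop

variable {R : Type*} [LinearOrderedAddCommMonoidWithTop R] {c : ι → ι → R} {g : ι → R}
  {T : Table ι R}

lemma IsSound.relaxLayer (h : T.IsSound c g) (r : ℕ) : (T.relaxLayer c x y r).IsSound c g :=
  foldr_induction (p := IsSound c g)
    (fun _ _ h => foldr_induction (fun _ _ h => h.lower_succ r _ _) h) h

lemma IsExact.relaxLayer {L : ℕ} (h : T.IsExact c g L)
    (hc : ∀ x' y', c x' y' ≠ ⊤ → ∃ i j, x i = x' ∧ y i j = y') :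
    (T.relaxLayer c x y L).IsExact c g (L + 1) where
  toIsSound := h.toIsSound.relaxLayer L
  dist_le_stopping z := ((lowersAbove_relaxLayer L T).dist_le _).trans (h.dist_le_stopping z)
  dist_le_step r hr x' y' := by
    rcases (Nat.le_of_lt_succ hr).lt_or_eq with hr | rfl
    · have hT := lowersAbove_relaxLayer (c := c) (x := x) (y := y) L T
      rw [hT.dist_eq (r + 1) hr, hT.dist_eq r hr.le]
      exact h.dist_le_step r hr x' y'
    · by_cases hxy : c x' y' = ⊤
      · simp [hxy]
      · obtain ⟨i, j, rfl, rfl⟩ := hc x' y' hxy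
        exact dist_relaxLayer_le r T i j

lemma IsExact.relaxLayers (h : T.IsExact c g 0)
    (hc : ∀ x' y', c x' y' ≠ ⊤ → ∃ i j, x i = x' ∧ y i j = y') (L : ℕ) :
    (T.relaxLayers c x y L).IsExact c g L := by
  induction L with
  | zero => simpa only [Table.relaxLayers, Fin.foldr_zero] using h
  | succ L ih =>
    have hL := ih.relaxLayer hc
    simp only [Table.relaxLayers, Fin.foldr_succ, Fin.rev_succ, Fin.val_castSucc, Fin.rev_zero,
      Fin.val_last] at hL ⊢
    exact hL

/-- Register that stopping in `x i` is free if `p i` holds. -/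
def seed (x : Fin d → ι) (p : Fin d → Prop) [DecidablePred p] (T : Table ι R) : Table ι R :=
  Fin.foldr d (fun i T => if p i then T.lower (0, x i) 0 (x i) else T) T

lemma IsSound.seed {p : Fin d → Prop} [DecidablePred p] (h : T.IsSound c g)
    (hp : ∀ i, p i → g (x i) = 0) (hg : ∀ z, g z ≠ ⊤ → ∃ i, p i ∧ x i = z) :
    (T.seed x p).IsExact c g 0 where
  toIsSound := foldr_induction (p := IsSound c g) (fun i T h => by
    split_ifs with hi
    · exact h.lower_zero (hp i hi).le _
    · exact h) h
  dist_le_stopping z := by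
    by_cases hz : g z = ⊤
    · exact hz ▸ le_top
    obtain ⟨i, hi, rfl⟩ := hg z hz
    refine foldr_forall (R := fun i (T : Table ι R) => p i → T.dist (0, x i) ≤ g (x i)) ?_ ?_ T i hi
    · intro i T hi
      rw [if_pos hi, hp i hi]
      exact dist_lower_self_le
    · intro i j T h hi
      split_ifs
      · exact (dist_lower_le _).trans (h hi)
      · exact h hi
  dist_le_step := by simp

end WithTop

end Relax

end Table

end Table

section Product

variable {V Q : Type*}

open Classical in
/-- The cost of a step in the product of the automaton `M` with the weighted graph: the automaton
reads the vertex that is left. -/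
noncomputable def stepCost (M : NFA V Q) (G : Digraph V) (wt : V → V → ℤ) (x y : Q × V) :
    WithTop ℤ :=
  if y.1 ∈ M.step x.1 x.2 ∧ G.Adj x.2 y.2 then (wt x.2 y.2 : ℤ) else ⊤

open Classical in
/-- The cost of stopping in the product of the automaton `M` with the weighted graph: a path that
ends in `b` costs nothing if `M` accepts after reading `b`. -/
noncomputable def stopCost (M : NFA V Q) (b : V) (x : Q × V) : WithTop ℤ :=
  if x.2 = b ∧ ∃ q ∈ M.step x.1 b, q ∈ M.accept then 0 else ⊤

variable {M : NFA V Q} {G : Digraph V} {wt : V → V → ℤ} {b : V}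

lemma stepCost_ne_top_iff {x y : Q × V} :
    stepCost M G wt x y ≠ ⊤ ↔ y.1 ∈ M.step x.1 x.2 ∧ G.Adj x.2 y.2 := by
  simp [stepCost]

lemma stopCost_ne_top_iff {x : Q × V} :
    stopCost M b x ≠ ⊤ ↔ x.2 = b ∧ ∃ q ∈ M.step x.1 b, q ∈ M.accept := by
  simp [stopCost]

lemma cons_mem_acceptsFrom_singleton {q : Q} {v : V} {p : List V} :
    v :: p ∈ M.acceptsFrom {q} ↔ ∃ q' ∈ M.step q v, p ∈ M.acceptsFrom {q'} := by
  rw [NFA.cons_mem_acceptsFrom, NFA.stepSet_singleton]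
  simp only [NFA.mem_acceptsFrom, NFA.mem_evalFrom_iff_exists (S := M.step q v)]
  aesop

lemma exists_walkCost_eq {q : Q} {v : V} {p : List V} (hM : v :: p ∈ M.acceptsFrom {q})
    (hG : (v :: p).IsChain G.Adj) (hb : (v :: p).getLast? = some b) :
    ∃ l : List (Q × V), l.length = p.length ∧
      walkCost (stepCost M G wt) (stopCost M b) (q, v) l = pathWeight wt (v :: p) := by
  obtain ⟨q', hq', hp⟩ := cons_mem_acceptsFrom_singleton.1 hM
  induction p generalizing q v q' with
  | nil =>
    obtain rfl : v = b := by simpa using hb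
    have : q' ∈ M.accept := by simpa using hp
    exact ⟨[], rfl, if_pos ⟨rfl, q', hq', this⟩⟩
  | cons u p ih =>
    obtain ⟨hvu, hG⟩ := List.isChain_cons_cons.1 hG
    obtain ⟨q'', hq'', hp'⟩ := cons_mem_acceptsFrom_singleton.1 hp
    obtain ⟨l, hl, hw⟩ := ih hp hG (by simpa using hb) q'' hq'' hp'
    refine ⟨(q', u) :: l, by simp [hl], ?_⟩
    rw [walkCost, hw, stepCost, if_pos ⟨hq', hvu⟩]
    rfl

lemma path_of_walkCost_ne_top {q : Q} {v : V} {l : List (Q × V)}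
    (h : walkCost (stepCost M G wt) (stopCost M b) (q, v) l ≠ ⊤) :
    v :: l.map Prod.snd ∈ M.acceptsFrom {q} ∧ (v :: l.map Prod.snd).IsChain G.Adj ∧
      (v :: l.map Prod.snd).getLast? = some b ∧
      walkCost (stepCost M G wt) (stopCost M b) (q, v) l = pathWeight wt (v :: l.map Prod.snd) := by
  induction l generalizing q v with
  | nil =>
    obtain ⟨rfl, q', hq', hacc⟩ := stopCost_ne_top_iff.1 h
    exact ⟨cons_mem_acceptsFrom_singleton.2 ⟨q', hq', by simpa using hacc⟩, .singleton _, rfl,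
      if_pos ⟨rfl, q', hq', hacc⟩⟩
  | cons y l ih =>
    rw [walkCost, WithTop.add_ne_top, stepCost_ne_top_iff] at h
    obtain ⟨⟨hq', hvu⟩, hl⟩ := h
    obtain ⟨hM, hG, hb, hw⟩ := ih hl
    refine ⟨cons_mem_acceptsFrom_singleton.2 ⟨_, hq', hM⟩, .cons_cons hvu hG, by simpa using hb, ?_⟩
    rw [walkCost, hw, stepCost, if_pos ⟨hq', hvu⟩]
    rfl

variable {n L : ℕ} {M : NFA (Fin n) Q} {G : Digraph (Fin n)} {wt : Fin n → Fin n → ℤ}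
  {a b : Fin n} {q₀ : Q} {T : Table (Q × Fin n) (WithTop ℤ)}

lemma isSimplePath_iff_acceptsFrom (hL : M.accepts = distinctWords n (L + 1))
    (hs : M.start = {q₀}) (p : List (Fin n)) :
    IsSimplePath G (L + 1) a b (a :: p) ↔
      a :: p ∈ M.acceptsFrom {q₀} ∧ (a :: p).IsChain G.Adj ∧ (a :: p).getLast? = some b := by
  rw [← hs, ← NFA.accepts_eq_acceptsFrom_start, hL]
  change _ ↔ ((a :: p).length = L + 1 ∧ (a :: p).Nodup) ∧ _
  simp [IsSimplePath, and_assoc]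

lemma IsSimplePath.dist_le (hL : M.accepts = distinctWords n (L + 1)) (hs : M.start = {q₀})
    (hT : T.IsExact (stepCost M G wt) (stopCost M b) L) {p : List (Fin n)}
    (hp : IsSimplePath G (L + 1) a b p) : T.dist (L, q₀, a) ≤ pathWeight wt p := by
  obtain ⟨p, rfl⟩ : ∃ p', p = a :: p' := List.head?_eq_some_iff.1 hp.2.2.2.1
  obtain ⟨hM, hG, hb⟩ := (isSimplePath_iff_acceptsFrom hL hs p).1 hp
  obtain ⟨l, hl, hw⟩ := exists_walkCost_eq (wt := wt) hM hG hb
  have hlL : l.length = L := by simpa [hl] using hp.1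
  simpa only [hlL, hw] using hT.dist_le_walkCost (q₀, a) l hlL.le

lemma isMinSimplePath_of_dist_ne_top (hL : M.accepts = distinctWords n (L + 1))
    (hs : M.start = {q₀}) (hT : T.IsExact (stepCost M G wt) (stopCost M b) L)
    (h : T.dist (L, q₀, a) ≠ ⊤) :
    IsMinSimplePath G wt (L + 1) a b (a :: (T.trace L (q₀, a)).map Prod.snd) := by
  have hle := hT.walkCost_trace_le L (q₀, a)
  obtain ⟨hM, hG, hb, hw⟩ := path_of_walkCost_ne_top (ne_top_of_le_ne_top h hle)
  refine ⟨(isSimplePath_iff_acceptsFrom hL hs _).2 ⟨hM, hG, hb⟩, fun p' hp' => ?_⟩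
  exact WithTop.coe_le_coe.1 (hw ▸ hle.trans (hp'.dist_le hL hs hT))

lemma not_isSimplePath_of_dist_eq_top (hL : M.accepts = distinctWords n (L + 1))
    (hs : M.start = {q₀}) (hT : T.IsExact (stepCost M G wt) (stopCost M b) L)
    (h : T.dist (L, q₀, a) = ⊤) (p : List (Fin n)) : ¬ IsSimplePath G (L + 1) a b p :=
  fun hp => WithTop.coe_ne_top (top_le_iff.1 (h ▸ hp.dist_le (wt := wt) hL hs hT))

end Product

section Address

variable {n m : ℕ}

lemma mul_add_inj {N i i' : ℕ} {j j' : Fin N} (h : i * N + j = i' * N + j') :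
    i = i' ∧ j = j' := by
  have : NeZero N := ⟨j.pos.ne'⟩
  exact Prod.mk.inj ((Nat.divModEquiv N).symm.injective (a₁ := (i, j)) (a₂ := (i', j')) h)

/-- The address of the entry for `(r, q, v)` in a table of bounds. -/
def adr (x : ℕ × Fin m × Fin n) : ℤ := ((x.1 * m + x.2.1) * n + x.2.2 : ℕ)

lemma adr_injective : Function.Injective (adr (n := n) (m := m)) := by
  rintro ⟨r, q, v⟩ ⟨r', q', v'⟩ h
  obtain ⟨h, rfl⟩ := mul_add_inj (Int.natCast_inj.1 h)
  obtain ⟨rfl, rfl⟩ := mul_add_inj h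
  rfl

/-- The address of the entry for an edge in the matrices of the graph. -/
def pos (u v : Fin n) : ℤ := (u * n + v : ℕ)

end Address

/-- An instance of the path problem for paths with `L + 1` vertices, with an automaton whose
transitions are listed by `e`, and bounds for the numbers involved: words have `w` bits and weights
are at most `W` in absolute value. -/
structure Problem (n m : ℕ) where
  G : Digraph (Fin n)
  wt : Fin n → Fin n → ℤ
  a : Fin n
  b : Fin n
  L : ℕ
  M : NFA (Fin n) (Fin m)
  q₀ : Fin m
  d : ℕ
  e : Fin d → Fin m × Fin n × Fin m
  w : ℕ
  W : ℕ
  accepts_eq : M.accepts = distinctWords n (L + 1)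
  start_eq : M.start = {q₀}
  range_e : Set.range e = transitions M
  L_lt : L < n
  n_lt : n < 2 ^ w
  m_lt : m < 2 ^ w
  d_lt : d < 2 ^ w
  one_le_W : 1 ≤ W
  abs_wt_le : ∀ u v, G.Adj u v → |wt u v| ≤ W

namespace Problem

variable {n m : ℕ} (P : Problem n m)

/-- The source of a transition. -/
def src (t : Fin P.d) : Fin m := (P.e t).1

/-- The label of a transition. -/
def lab (t : Fin P.d) : Fin n := (P.e t).2.1

/-- The target of a transition. -/
def tgt (t : Fin P.d) : Fin m := (P.e t).2.2

lemma tgt_mem_step (t : Fin P.d) : P.tgt t ∈ P.M.step (P.src t) (P.lab t) :=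
  P.range_e.subset (Set.mem_range_self t)

lemma exists_transition {q q' : Fin m} {v : Fin n} (h : q' ∈ P.M.step q v) :
    ∃ t, P.src t = q ∧ P.lab t = v ∧ P.tgt t = q' := by
  obtain ⟨t, ht⟩ : (q, v, q') ∈ Set.range P.e := P.range_e ▸ h
  exact ⟨t, by simp [src, lab, tgt, ht]⟩

open Classical in
/-- The table of the cheapest walks with no steps in the product of the automaton with the graph. -/
noncomputable def seedTable : Table (Fin m × Fin n) (WithTop ℤ) :=
  Table.empty.seed (fun t => (P.src t, P.lab t)) fun t => P.lab t = P.b ∧ P.tgt t ∈ P.M.accept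

/-- The table of the cheapest walks with at most `P.L` steps in the product of the automaton with
the graph. -/
noncomputable def table : Table (Fin m × Fin n) (WithTop ℤ) :=
  P.seedTable.relaxLayers (stepCost P.M P.G P.wt) (fun t => (P.src t, P.lab t))
    (fun t u => (P.tgt t, u)) P.L

lemma isExact_seedTable :
    P.seedTable.IsExact (stepCost P.M P.G P.wt) (stopCost P.M P.b) 0 := by
  classical
  refine Table.isSound_empty.seed (fun t ht => ?_) fun z hz => ?_
  · exact if_pos ⟨ht.1, P.tgt t, ht.1 ▸ P.tgt_mem_step t, ht.2⟩
  · obtain ⟨hb, q, hq, hacc⟩ := stopCost_ne_top_iff.1 hz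
    obtain ⟨t, hsrc, hlab, rfl⟩ := P.exists_transition hq
    exact ⟨t, ⟨hlab, hacc⟩, Prod.ext hsrc (hlab.trans hb.symm)⟩

lemma isExact_table : P.table.IsExact (stepCost P.M P.G P.wt) (stopCost P.M P.b) P.L := by
  refine P.isExact_seedTable.relaxLayers (fun x y hxy => ?_) P.L
  obtain ⟨t, hsrc, hlab, htgt⟩ := P.exists_transition (stepCost_ne_top_iff.1 hxy).1
  exact ⟨t, y.2, Prod.ext hsrc hlab, Prod.ext htgt rfl⟩

/-- A bound for the cost of an instruction in the solution of the problem. -/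
def K : ℕ := 3 * (4 + Nat.size P.W)

/-- The integer `x` is short enough for an instruction to take time at most `P.K`. -/
abbrev Fits (x : ℤ) : Prop := WordRAM.Fits P.w P.K x

lemma one_le_w : 1 ≤ P.w := by
  have hpow : 1 < 2 ^ P.w := (Nat.succ_le_of_lt (Nat.zero_lt_of_lt P.L_lt)).trans_lt P.n_lt
  exact Nat.one_le_iff_ne_zero.2 (Nat.one_lt_two_pow_iff.1 hpow)

lemma one_le_K : 1 ≤ P.K := by
  unfold K
  omega

variable {P}

lemma fits_of_abs_le {x : ℤ} (h : |x| ≤ 2 ^ (3 * P.w) * P.W) : P.Fits x := by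
  have hnat : x.natAbs < 2 ^ (3 * P.w + Nat.size P.W) := by
    calc x.natAbs ≤ 2 ^ (3 * P.w) * P.W := by zify; exact h
      _ < 2 ^ (3 * P.w) * 2 ^ Nat.size P.W :=
        Nat.mul_lt_mul_of_pos_left (Nat.lt_size_self _) (by positivity)
      _ = _ := (pow_add ..).symm
  have hlen := len_le P.one_le_w 3 (Nat.size P.W) hnat
  unfold Fits WordRAM.Fits K
  omega

lemma fits_natCast {x : ℕ} (h : x ≤ 2 ^ (3 * P.w)) : P.Fits x := by
  refine fits_of_abs_le ?_
  rw [Nat.abs_cast]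
  exact_mod_cast h.trans (Nat.le_mul_of_pos_right _ P.one_le_W)

lemma fits_natCast_of_lt {x : ℕ} (h : x < 2 ^ P.w) : P.Fits x :=
  fits_natCast (h.le.trans (Nat.pow_le_pow_right two_pos (by omega)))

lemma fits_zero : P.Fits 0 := fits_of_abs_le (by positivity)

lemma fits_one : P.Fits 1 := by exact_mod_cast fits_natCast (x := 1) Nat.one_le_two_pow

lemma fits_vertex (v : Fin n) : P.Fits (v : ℕ) := fits_natCast_of_lt (v.2.trans P.n_lt)

lemma fits_state (q : Fin m) : P.Fits (q : ℕ) := fits_natCast_of_lt (q.2.trans P.m_lt)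

lemma fits_transition (t : Fin P.d) : P.Fits (t : ℕ) := fits_natCast_of_lt (t.2.trans P.d_lt)

lemma fits_length {r : ℕ} (hr : r ≤ P.L) : P.Fits r :=
  fits_natCast_of_lt (hr.trans_lt (P.L_lt.trans P.n_lt))

lemma row_lt {r : ℕ} (hr : r ≤ P.L) (q : Fin m) : r * m + q < 2 ^ (2 * P.w) := by
  have hr := hr.trans_lt P.L_lt
  have hn := P.n_lt
  have hm := P.m_lt
  rw [two_mul, pow_add]
  nlinarith [q.2]

lemma fits_row {r : ℕ} (hr : r ≤ P.L) (q : Fin m) : P.Fits (r * m + q : ℕ) :=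
  fits_natCast ((row_lt hr q).le.trans (Nat.pow_le_pow_right two_pos (by omega)))

lemma fits_adr {x : ℕ × Fin m × Fin n} (hx : x.1 ≤ P.L) : P.Fits (adr x) := by
  have hn := P.n_lt
  refine fits_natCast ?_
  calc (x.1 * m + x.2.1) * n + x.2.2 ≤ (x.1 * m + x.2.1 + 1) * n := by linarith [x.2.2.2]
    _ ≤ 2 ^ (2 * P.w) * 2 ^ P.w := Nat.mul_le_mul (row_lt hx x.2.1) hn.le
    _ = _ := by ring

lemma fits_pos (u v : Fin n) : P.Fits (pos u v) := by
  have hn := P.n_lt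
  refine fits_natCast ?_
  calc u * n + v ≤ (u + 1) * n := by linarith [v.2]
    _ ≤ 2 ^ P.w * 2 ^ P.w := Nat.mul_le_mul (u.2.trans hn) hn.le
    _ ≤ _ := by rw [← pow_add]; exact Nat.pow_le_pow_right two_pos (by omega)

lemma len_mul_len_le {x y : ℕ} (hx : x < 2 ^ (2 * P.w)) (hy : y < 2 ^ P.w) :
    len P.w x * len P.w y ≤ P.K := by
  have hx := len_le P.one_le_w 2 0 (x := x) (by simpa using hx)
  have hy := len_le P.one_le_w 1 0 (x := y) (by simpa using hy)
  calc len P.w x * len P.w y ≤ 3 * 2 := Nat.mul_le_mul hx hy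
    _ ≤ P.K := by unfold K; omega

lemma fits_of_abs_le_mul {x : ℤ} (h : |x| ≤ 2 * n * P.W) : P.Fits x := by
  refine fits_of_abs_le (h.trans ?_)
  have hpow : 2 * n ≤ 2 ^ (3 * P.w) := by
    calc 2 * n ≤ 2 * 2 ^ P.w := Nat.mul_le_mul_left 2 P.n_lt.le
      _ = 2 ^ (P.w + 1) := (Nat.pow_succ').symm
      _ ≤ _ := Nat.pow_le_pow_right two_pos (by have := P.one_le_w; omega)
  exact_mod_cast Nat.mul_le_mul_right _ hpow

lemma fits_vertex_sub (u v : Fin n) : P.Fits ((u : ℕ) - (v : ℕ)) := by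
  refine fits_of_abs_le_mul ?_
  have := P.one_le_W
  rw [abs_le]
  constructor <;> nlinarith [u.2, v.2]

end Problem

-- A program writes only to the registers from its own outputs on, up to 31: a subroutine uses
-- higher registers than its callers.  The registers from 32 on belong to the automaton.
local notation "rN" => (0 : ℕ)
local notation "rK" => (1 : ℕ)
local notation "rA" => (2 : ℕ)
local notation "rB" => (3 : ℕ)
local notation "rZero" => (4 : ℕ)
local notation "rOne" => (5 : ℕ)
local notation "rLast" => (6 : ℕ)
local notation "rLayer" => (7 : ℕ)
local notation "rRank" => (8 : ℕ)
local notation "rPrev" => (9 : ℕ)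
local notation "rTrans" => (10 : ℕ)
local notation "rSrc" => (11 : ℕ)
local notation "rLab" => (12 : ℕ)
local notation "rTgt" => (13 : ℕ)
local notation "rVert" => (14 : ℕ)
local notation "rEntry" => (15 : ℕ)
local notation "rNext" => (16 : ℕ)
local notation "rDist" => (17 : ℕ)
local notation "rTmp" => (18 : ℕ)
local notation "rM" => (32 : ℕ)
local notation "rD" => (33 : ℕ)
local notation "rStart" => (34 : ℕ)

local notation "bAdj" => (0 : ℕ)
local notation "bWt" => (1 : ℕ)
local notation "bMark" => (2 : ℕ)
local notation "bDist" => (3 : ℕ)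
local notation "bNext" => (4 : ℕ)
local notation "bVert" => (5 : ℕ)
local notation "bSrc" => (8 : ℕ)
local notation "bLab" => (9 : ℕ)
local notation "bTgt" => (10 : ℕ)
local notation "bAcc" => (11 : ℕ)

local notation:60 c:61 " ;; " d:60 => Cmd.seq c d

namespace Problem

section Invariants

variable {n m : ℕ} {P : Problem n m} {σ τ υ : Store}

open Classical in
/-- The store holds the data of the problem, in the layout that the search relies on. -/
structure Loaded (P : Problem n m) (σ : Store) : Prop where
  reg_n : σ.reg rN = n
  reg_a : σ.reg rA = (P.a : ℕ)
  reg_b : σ.reg rB = (P.b : ℕ)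
  reg_zero : σ.reg rZero = 0
  reg_one : σ.reg rOne = 1
  reg_last : σ.reg rLast = P.L
  reg_m : σ.reg rM = m
  reg_d : σ.reg rD = P.d
  reg_start : σ.reg rStart = (P.q₀ : ℕ)
  adj : ∀ u v, σ.mem bAdj (pos u v) = if P.G.Adj u v then 1 else 0
  wt : ∀ u v, P.G.Adj u v → σ.mem bWt (pos u v) = P.wt u v
  src : ∀ t : Fin P.d, σ.mem bSrc (t : ℕ) = (P.src t : ℕ)
  lab : ∀ t : Fin P.d, σ.mem bLab (t : ℕ) = (P.lab t : ℕ)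
  tgt : ∀ t : Fin P.d, σ.mem bTgt (t : ℕ) = (P.tgt t : ℕ)
  acc : ∀ q : Fin m, σ.mem bAcc (q : ℕ) = if q ∈ P.M.accept then 1 else 0

/-- The frame of the programs of the search, which write only to the registers from `lo` to 31 and
to the banks 2 to 7. -/
abbrev Frame (lo : ℕ) (σ τ : Store) : Prop := σ.AgreeOff (Set.Ico lo 32) (Set.Ico 2 8) τ

lemma Loaded.of_frame {lo : ℕ} (h : P.Loaded σ) (hτ : Frame lo σ τ) (hlo : 7 ≤ lo := by simp) :
    P.Loaded τ := by
  replace hτ : Frame 7 σ τ := hτ.mono (Set.Ico_subset_Ico_left hlo) subset_rfl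
  have hreg {r : ℕ} {x : ℤ} (h : σ.reg r = x) (hr : r ∉ Set.Ico 7 32) : τ.reg r = x :=
    (hτ.reg r hr).trans h
  have hmem {b : ℕ} {x y : ℤ} (h : σ.mem b x = y) (hb : b ∉ Set.Ico 2 8) : τ.mem b x = y :=
    (congrFun (hτ.mem b hb) x).trans h
  exact
  { reg_n := hreg h.reg_n (by simp)
    reg_a := hreg h.reg_a (by simp)
    reg_b := hreg h.reg_b (by simp)
    reg_zero := hreg h.reg_zero (by simp)
    reg_one := hreg h.reg_one (by simp)
    reg_last := hreg h.reg_last (by simp)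
    reg_m := hreg h.reg_m (by simp)
    reg_d := hreg h.reg_d (by simp)
    reg_start := hreg h.reg_start (by simp)
    adj := fun u v => hmem (h.adj u v) (by simp)
    wt := fun u v huv => hmem (h.wt u v huv) (by simp)
    src := fun t => hmem (h.src t) (by simp)
    lab := fun t => hmem (h.lab t) (by simp)
    tgt := fun t => hmem (h.tgt t) (by simp)
    acc := fun q => hmem (h.acc q) (by simp) }

lemma Loaded.setReg (h : P.Loaded σ) {r : ℕ} (hr : r ∈ Set.Ico 7 32) (x : ℤ) :
    P.Loaded (σ.setReg r x) :=
  h.of_frame ((Store.AgreeOff.refl ..).setReg hr x)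

/-- The memory holds the table: for each known walk from `x`, the cost, and, as the next node, both
the address of its entry and its vertex.  The bound keeps the numbers short. -/
structure Stores (P : Problem n m) (T : Table (Fin m × Fin n) (WithTop ℤ))
    (mem : ℕ → ℤ → ℤ) : Prop where
  unmarked : ∀ x, T.dist x = ⊤ → mem bMark (adr x) = 0
  marked : ∀ x, T.dist x ≠ ⊤ → mem bMark (adr x) = 1
  dist : ∀ x, ∀ z : ℤ, T.dist x = z → mem bDist (adr x) = z
  next : ∀ x, T.dist x ≠ ⊤ → mem bNext (adr x) = adr (x.1 - 1, T.next x)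
  vert : ∀ x, T.dist x ≠ ⊤ → mem bVert (adr x) = ((T.next x).2 : ℕ)
  abs_le : ∀ x, ∀ z : ℤ, T.dist x = z → |z| ≤ x.1 * P.W

/-- The store `τ` has been reached from `σ` within the frame, and it holds the table. -/
structure Reached (P : Problem n m) (lo : ℕ) (σ : Store)
    (T : Table (Fin m × Fin n) (WithTop ℤ)) (τ : Store) : Prop where
  frame : Frame lo σ τ
  stores : P.Stores T τ.mem

lemma Reached.trans {lo lo' : ℕ} {T : Table (Fin m × Fin n) (WithTop ℤ)}
    (h : Frame lo σ τ) (h' : P.Reached lo' τ T υ) (hlo : lo ≤ lo') : P.Reached lo σ T υ :=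
  ⟨h.trans (h'.frame.mono (Set.Ico_subset_Ico_left hlo) subset_rfl), h'.stores⟩

end Invariants

section Arithmetic

variable {n m : ℕ} {P : Problem n m} {σ : Store} {Q : Store → Prop} {r x y z : ℕ}

/-- Compute the address of an entry of the table from the length of the walk, the state and the
vertex. -/
def adrCmd (r x y z : ℕ) : Cmd :=
  .arith .mul r x rM ;; .arith .add r r y ;; .arith .mul r r rN ;; .arith .add r r z

/-- Compute the address of an entry of the matrices of the graph. -/
def posCmd (r x y : ℕ) : Cmd :=
  .arith .mul r x rN ;; .arith .add r r y

lemma within_adrCmd (hσ : P.Loaded σ) {p : ℕ × Fin m × Fin n} (hp : p.1 ≤ P.L)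
    (hx : σ.reg x = p.1) (hy : σ.reg y = (p.2.1 : ℕ)) (hz : σ.reg z = (p.2.2 : ℕ))
    (hr : r ≠ rN) (hry : y ≠ r) (hrz : z ≠ r) (h : Q (σ.setReg r (adr p))) :
    Within P.w P.K (adrCmd r x y z) σ 4 Q := by
  obtain ⟨i, q, v⟩ := p
  refine (Within.mul hx hσ.reg_m (len_mul_len_le ?_ P.m_lt) ?_).seq
  · exact (hp.trans_lt (P.L_lt.trans P.n_lt)).trans_le (Nat.pow_le_pow_right two_pos (by omega))
  refine (Within.add (u := (i * m : ℕ)) (by simp) (by simpa [hry] using hy)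
    ((fits_row hp q).mono (Nat.le_add_right ..)) (fits_state q) ?_ ?_).seq
  · exact_mod_cast fits_row hp q
  refine (Within.mul (u := (i * m + q : ℕ)) (by simp) (by simpa [hr.symm] using hσ.reg_n)
    (len_mul_len_le (row_lt hp q) P.n_lt) ?_).seq
  refine Within.add (u := ((i * m + q) * n : ℕ)) (by simp) (by simpa [hrz] using hz)
    ((fits_adr (x := (i, q, v)) hp).mono (Nat.le_add_right ..)) (fits_vertex v) ?_ ?_
  · exact_mod_cast fits_adr (x := (i, q, v)) hp
  · simpa [Store.setReg_setReg, adr] using h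

lemma within_posCmd (hσ : P.Loaded σ) {u v : Fin n} (hx : σ.reg x = (u : ℕ))
    (hy : σ.reg y = (v : ℕ)) (hry : y ≠ r) (h : Q (σ.setReg r (pos u v))) :
    Within P.w P.K (posCmd r x y) σ 2 Q := by
  have hu : (u : ℕ) < 2 ^ P.w := u.2.trans P.n_lt
  refine (Within.mul hx hσ.reg_n (len_mul_len_le ?_ P.n_lt) ?_).seq
  · exact hu.trans_le (Nat.pow_le_pow_right two_pos (by omega))
  refine Within.add (u := (u * n : ℕ)) (by simp) (by simpa [hry] using hy)
    ((fits_pos u v).mono (Nat.le_add_right ..)) (fits_vertex v) ?_ ?_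
  · exact_mod_cast fits_pos u v
  · simpa [Store.setReg_setReg, pos] using h

end Arithmetic

section Improve

variable {n m : ℕ} {P : Problem n m} {σ : Store} {T : Table (Fin m × Fin n) (WithTop ℤ)}

/-- Overwrite the entry of the table at the address `rEntry`. -/
def writeCmd : Cmd :=
  .store bMark rEntry rOne ;; .store bDist rEntry rDist ;; .store bNext rEntry rNext ;;
    .store bVert rEntry rVert

/-- Put a positive number into `rTmp` if and only if the entry of the table at the address `rEntry`
is absent or greater than `rDist`. -/
def compareCmd : Cmd :=
  .load rTmp bMark rEntry ;;
    .branch rTmp (.load rTmp bDist rEntry ;; .arith .sub rTmp rTmp rDist) (.const rTmp 1)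

/-- Lower an entry of the table, as in `Table.lower`. -/
def improveCmd : Cmd :=
  compareCmd ;; .branch rTmp writeCmd .skip

/-- The registers from `rVert` to `rDist` describe a walk that starts in `x`, continues with `y` and
costs `z`. -/
structure Candidate (P : Problem n m) (x : ℕ × Fin m × Fin n) (y : Fin m × Fin n) (z : ℤ)
    (σ : Store) : Prop where
  reg_entry : σ.reg rEntry = adr x
  reg_next : σ.reg rNext = adr (x.1 - 1, y)
  reg_vert : σ.reg rVert = (y.2 : ℕ)
  reg_dist : σ.reg rDist = z
  le_L : x.1 ≤ P.L
  abs_le : |z| ≤ x.1 * P.W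

variable {x : ℕ × Fin m × Fin n} {y : Fin m × Fin n} {z : ℤ}

lemma fits_of_abs_le_rank {x : ℕ} {z : ℤ} (hx : x ≤ P.L) (hz : |z| ≤ x * P.W) : P.Fits z := by
  have hxn : x ≤ 2 * n := by have := P.L_lt; omega
  exact fits_of_abs_le_mul (hz.trans (by exact_mod_cast Nat.mul_le_mul_right _ hxn))

lemma stores_write (hT : P.Stores T σ.mem) (hz : |z| ≤ x.1 * P.W) (hlt : z < T.dist x) :
    P.Stores (T.lower x z y) ((((σ.setMem bMark (adr x) 1).setMem bDist (adr x) z).setMem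
      bNext (adr x) (adr (x.1 - 1, y))).setMem bVert (adr x) (y.2 : ℕ)).mem := by
  obtain ⟨unmarked, marked, dist, next, vert, abs_le⟩ := hT
  rw [Table.lower, if_pos hlt]
  constructor <;> intro x' <;> rcases eq_or_ne x' x with rfl | hne
  case unmarked.inr | marked.inr | dist.inr | next.inr | vert.inr | abs_le.inr =>
    simp only [Store.mem_setMem, Function.update_of_ne hne,
      Function.update_of_ne (adr_injective.ne hne), Nat.reduceEqDiff, if_true, if_false]
    solve_by_elim
  all_goals simp +contextual [hz]

lemma within_compareCmd (hT : P.Stores T σ.mem) (h : P.Candidate x y z σ) :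
    Within P.w P.K compareCmd σ 4 fun τ => ∃ u, τ = σ.setReg rTmp u ∧ P.Fits u ∧
      (0 < u ↔ z < T.dist x) := by
  have hadr : P.Fits (adr x) := fits_adr h.le_L
  have hz := fits_of_abs_le_rank h.le_L h.abs_le
  cases hd : T.dist x with
  | top =>
    have hmark := hT.unmarked x hd
    refine (Within.load h.reg_entry hmark hadr fits_zero ?_).seq
    refine .branch (v := 0) (T := 2) (by simp) fits_zero (fun h => absurd h (lt_irrefl 0))
      fun _ => ?_
    refine (Within.const fits_one ?_).of_le one_le_two
    exact ⟨1, by simp [Store.setReg_setReg], fits_one, by simp⟩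
  | coe d =>
    have hmark := hT.marked x (by simp [hd])
    have habs := hT.abs_le x d hd
    have hd' := fits_of_abs_le_rank h.le_L habs
    have hsub : P.Fits (d - z) := by
      have hxn : 2 * x.1 ≤ 2 * n := by have := h.le_L; have := P.L_lt; omega
      refine fits_of_abs_le_mul ((abs_sub d z).trans ?_)
      calc |d| + |z| ≤ x.1 * P.W + x.1 * P.W := add_le_add habs h.abs_le
        _ = (2 * x.1 : ℕ) * P.W := by push_cast; ring
        _ ≤ 2 * n * P.W := by exact_mod_cast Nat.mul_le_mul_right _ hxn
    refine (Within.load h.reg_entry hmark hadr fits_one ?_).seq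
    refine .branch (v := 1) (T := 2) (by simp) fits_one (fun _ => ?_) fun h => absurd h (by simp)
    refine (Within.load (by simpa using h.reg_entry) (by exact hT.dist x d hd) hadr hd' ?_).seq
    refine .sub (u := d) (v := z) (by simp) (by simpa using h.reg_dist) hd' hz hsub ?_
    exact ⟨d - z, by simp [Store.setReg_setReg], hsub, by simp⟩

lemma within_improveCmd (hσ : P.Loaded σ) (hT : P.Stores T σ.mem) (h : P.Candidate x y z σ) :
    Within P.w P.K improveCmd σ 9 (P.Reached rTmp σ (T.lower x z y)) := by
  have hadr : P.Fits (adr x) := fits_adr h.le_L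
  refine ((within_compareCmd hT h).imp ?_).seq
  rintro _ ⟨u, rfl, hu, hlt⟩
  have hframe : Frame rTmp σ (σ.setReg rTmp u) := (Store.AgreeOff.refl ..).setReg (by simp) u
  refine .branch (v := u) (T := 4) (by simp) hu (fun hpos => ?_) fun hneg => ?_
  · refine (Within.store (by simpa using h.reg_entry) (by simpa using hσ.reg_one) hadr fits_one
      ?_).seq
    refine (Within.store (by simpa using h.reg_entry) (by simpa using h.reg_dist) hadr
      (fits_of_abs_le_rank h.le_L h.abs_le) ?_).seq
    refine (Within.store (by simpa using h.reg_entry) (by simpa using h.reg_next) hadr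
      (fits_adr (x := (x.1 - 1, y)) ((Nat.sub_le ..).trans h.le_L)) ?_).seq
    refine .store (by simpa using h.reg_entry) (by simpa using h.reg_vert) hadr
      (fits_vertex _) ⟨?_, ?_⟩
    · exact (((hframe.setMem (by simp) ..).setMem (by simp) ..).setMem (by simp) ..).setMem
        (by simp) ..
    · exact stores_write hT h.abs_le (hlt.1 hpos)
  · refine (Within.skip P.one_le_K ⟨hframe, ?_⟩).of_le (by omega)
    rwa [Table.lower, if_neg (mt hlt.2 hneg.not_gt)]

end Improve

section Search

variable {n m : ℕ} {P : Problem n m} {σ : Store} {T : Table (Fin m × Fin n) (WithTop ℤ)}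
  {Q : Store → Prop} {t : Fin P.d}

lemma within_forDown {c : Cmd} {r x N B : ℕ} {f : Fin N → Table (Fin m × Fin n) (WithTop ℤ) →
      Table (Fin m × Fin n) (WithTop ℤ)} (hr : r ∈ Set.Ico 7 32) (hσ : P.Loaded σ)
    (hT : P.Stores T σ.mem) (hx : σ.reg x = N) (hN : P.Fits N)
    (hbody : ∀ (i : Fin N) T τ, Frame r σ τ → P.Loaded τ → P.Stores T τ.mem →
      τ.reg r = (i : ℕ) → Within P.w P.K c τ B (P.Reached (r + 1) τ (f i T))) :
    Within P.w P.K (.forDown rZero rOne r x c) σ (1 + (N + 1) * (B + 2))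
      (P.Reached r σ (Fin.foldr N f T)) := by
  have hloaded {τ : Store} (h : Frame r σ τ) : P.Loaded τ := hσ.of_frame h hr.1
  refine Within.forDown (fun T τ z hτ => ⟨hτ.frame.setReg (by simpa using hr.2) z, hτ.stores⟩)
    (fun T τ hτ => (hloaded hτ.frame).reg_one) (fun i hi => hN.mono hi) (fun i T τ hτ hi => ?_)
    ⟨.refl .., hT⟩ hσ.reg_zero hx
  refine (hbody i T τ hτ.frame (hloaded hτ.frame) hτ.stores hi).imp fun υ hυ => ?_
  exact ⟨.trans hτ.frame hυ r.le_succ, (hυ.frame.reg r (by simp)).trans hi⟩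

/-- Load the transition with the number `rTrans`. -/
def fetchCmd : Cmd :=
  .load rSrc bSrc rTrans ;; .load rLab bLab rTrans ;; .load rTgt bTgt rTrans

/-- `σ`, with a transition in the registers for it. -/
def fetch (P : Problem n m) (t : Fin P.d) (σ : Store) : Store :=
  ((σ.setReg rSrc (P.src t : ℕ)).setReg rLab (P.lab t : ℕ)).setReg rTgt (P.tgt t : ℕ)

lemma within_fetchCmd (hσ : P.Loaded σ) (ht : σ.reg rTrans = (t : ℕ)) (h : Q (P.fetch t σ)) :
    Within P.w P.K fetchCmd σ 3 Q := by
  refine (Within.load ht (hσ.src t) (fits_transition t) (fits_state _) ?_).seq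
  refine (Within.load (by simpa using ht) (by exact hσ.lab t) (fits_transition t)
    (fits_vertex _) ?_).seq
  exact .load (by simpa using ht) (hσ.tgt t) (fits_transition t) (fits_state _) h

lemma frame_fetch (t : Fin P.d) (σ : Store) : Frame rSrc σ (P.fetch t σ) :=
  (((Store.AgreeOff.refl ..).setReg (by simp) _).setReg (by simp) _).setReg (by simp) _

/-- Enter the walk without steps that starts with the transition in the registers. -/
def enterCmd : Cmd :=
  adrCmd rEntry rZero rSrc rLab ;; .arith .add rNext rEntry rZero ;; .arith .add rVert rLab rZero ;;
    .const rDist 0 ;; improveCmd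

lemma within_enterCmd (hσ : P.Loaded σ) (hT : P.Stores T σ.mem)
    (hsrc : σ.reg rSrc = (P.src t : ℕ)) (hlab : σ.reg rLab = (P.lab t : ℕ)) :
    Within P.w P.K enterCmd σ 16
      (P.Reached rVert σ (T.lower (0, P.src t, P.lab t) 0 (P.src t, P.lab t))) := by
  have hadr : P.Fits (adr (0, P.src t, P.lab t)) := fits_adr (Nat.zero_le _)
  have hlab' := P.fits_vertex (P.lab t)
  refine (within_adrCmd hσ (p := (0, P.src t, P.lab t)) (Nat.zero_le _) hσ.reg_zero hsrc hlab
    (by simp) (by simp) (by simp) ?_).seq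
  refine (Within.add (u := adr (0, P.src t, P.lab t)) (by simp) (by simpa using hσ.reg_zero) hadr
    fits_zero (by simpa) ?_).seq
  refine (Within.add (by simpa using hlab) (by simpa using hσ.reg_zero) hlab' fits_zero (by simpa)
    ?_).seq
  refine (Within.const fits_zero ?_).seq
  have hframe (u u' v v' : ℤ) : Frame rVert σ
      ((((σ.setReg rEntry u).setReg rNext u').setReg rVert v).setReg rDist v') :=
    ((((Store.AgreeOff.refl ..).setReg (by simp) _).setReg (by simp) _).setReg (by simp) _).setReg
      (by simp) _
  refine (within_improveCmd (hσ.of_frame (hframe ..)) hT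
    (x := (0, P.src t, P.lab t)) (y := (P.src t, P.lab t)) (z := 0) ?_).mono (by omega)
    fun τ hτ => .trans (hframe ..) hτ (by simp)
  constructor <;> simp

/-- Run `c` if the registers `x` and `y` hold the same vertex. -/
def ifEqCmd (x y : ℕ) (c : Cmd) : Cmd :=
  .arith .sub rTmp x y ;; .branch rTmp .skip
    (.arith .sub rTmp y x ;; .branch rTmp .skip c)

lemma within_ifEqCmd {x y B : ℕ} {c : Cmd} {u v : Fin n} (hx : σ.reg x = (u : ℕ))
    (hy : σ.reg y = (v : ℕ)) (hxr : x ≠ rTmp) (hyr : y ≠ rTmp)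
    (heq : u = v → Within P.w P.K c (σ.setReg rTmp 0) B Q)
    (hne : u ≠ v → ∀ z, Q (σ.setReg rTmp z)) (hB : 1 ≤ B) :
    Within P.w P.K (ifEqCmd x y c) σ (4 + B) Q := by
  have huv := P.fits_vertex_sub u v
  have hvu := P.fits_vertex_sub v u
  have hskip {B z} (hB : 1 ≤ B) (h : u ≠ v) : Within P.w P.K .skip (σ.setReg rTmp z) B Q :=
    (Within.skip P.one_le_K (hne h z)).of_le hB
  refine (Within.sub hx hy (fits_vertex _) (fits_vertex _) huv ?_).seq
  refine (Within.branch (T := 2 + B) (by simp) huv (fun h => hskip (by omega) (by grind))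
    fun h => ?_).of_le (by omega)
  refine (Within.sub (u := (v : ℕ)) (v := (u : ℕ)) (by simpa [hyr] using hy)
    (by simpa [hxr] using hx) (fits_vertex _) (fits_vertex _) hvu ?_).seq
  rw [Store.setReg_setReg]
  refine (Within.branch (T := B) (by simp) hvu (fun h => hskip hB (by grind)) fun h' => ?_).of_le
    (by omega)
  have huv : u = v := by omega
  subst huv
  simpa using heq rfl

/-- Enter the walk without steps that starts with the transition `rTrans`, if that transition reads
the vertex `rB` and leads into an accepting state. -/
def seedCmd : Cmd :=
  fetchCmd ;; .load rTmp bAcc rTgt ;; .branch rTmp (ifEqCmd rLab rB enterCmd) .skip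

lemma within_seedCmd (hσ : P.Loaded σ) (hT : P.Stores T σ.mem) (ht : σ.reg rTrans = (t : ℕ))
    [Decidable (P.lab t = P.b ∧ P.tgt t ∈ P.M.accept)] :
    Within P.w P.K seedCmd σ 25 (P.Reached rSrc σ
      (if P.lab t = P.b ∧ P.tgt t ∈ P.M.accept then
        T.lower (0, P.src t, P.lab t) 0 (P.src t, P.lab t) else T)) := by
  refine (within_fetchCmd hσ ht ?_).seq
  have hloaded := hσ.of_frame (frame_fetch t σ)
  have hframe (z : ℤ) : Frame rSrc σ ((P.fetch t σ).setReg rTmp z) :=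
    (frame_fetch t σ).setReg (by simp) z
  refine (Within.load (u := (P.tgt t : ℕ)) (by simp [fetch]) (hloaded.acc _) (fits_state _)
    (by split_ifs; exacts [fits_one, fits_zero]) ?_).seq
  refine .branch (T := 20) (by simp; rfl) (by split_ifs; exacts [fits_one, fits_zero])
    (fun h => ?_) fun h => ?_
  · have hacc : P.tgt t ∈ P.M.accept := by_contra fun hacc => by simp [hacc] at h
    refine within_ifEqCmd (B := 16) (u := P.lab t) (v := P.b) (by simp [fetch])
      (by simpa [fetch] using hσ.reg_b) (by simp) (by simp) (fun hb => ?_) (fun hb z => ?_)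
      (by simp)
    · rw [Store.setReg_setReg, if_pos ⟨hb, hacc⟩]
      exact (within_enterCmd (hσ.of_frame (hframe 0)) hT (by simp [fetch]) (by simp [fetch])).imp
        fun τ hτ => .trans (hframe 0) hτ (by simp)
    · rw [Store.setReg_setReg, if_neg fun h => hb h.1]
      exact ⟨hframe z, hT⟩
  · have hacc : ¬ (P.lab t = P.b ∧ P.tgt t ∈ P.M.accept) := fun hacc => by simp [hacc.2] at h
    rw [if_neg hacc]
    exact (Within.skip P.one_le_K ⟨hframe _, hT⟩).of_le (by simp)

end Search

section Relax

variable {n m : ℕ} {P : Problem n m} {σ τ : Store} {T : Table (Fin m × Fin n) (WithTop ℤ)} {r : ℕ}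
  {t : Fin P.d} {u : Fin n}

/-- Consider the walk that starts with the transition in the registers and the edge to `rVert` and
continues as recorded in the table entry at `rNext`. -/
def extendCmd : Cmd :=
  posCmd rTmp rLab rVert ;; .load rTmp bWt rTmp ;; .load rDist bDist rNext ;;
    .arith .add rDist rTmp rDist ;; adrCmd rEntry rRank rSrc rLab ;; improveCmd

/-- Relax the step that reads the transition in the registers and follows the edge to `rVert`. -/
def followCmd : Cmd :=
  adrCmd rNext rPrev rTgt rVert ;; .load rTmp bMark rNext ;; .branch rTmp extendCmd .skip

/-- Relax the step that reads the transition in the registers and moves to `rVert`, if there is an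
edge. -/
def relaxCmd : Cmd :=
  posCmd rTmp rLab rVert ;; .load rTmp bAdj rTmp ;; .branch rTmp followCmd .skip

/-- The registers say that walks with `r + 1` steps starting with the transition `t` are being
processed. -/
structure AtStep (P : Problem n m) (r : ℕ) (t : Fin P.d) (σ : Store) : Prop where
  reg_rank : σ.reg rRank = (r + 1 : ℕ)
  reg_prev : σ.reg rPrev = r
  reg_src : σ.reg rSrc = (P.src t : ℕ)
  reg_lab : σ.reg rLab = (P.lab t : ℕ)
  reg_tgt : σ.reg rTgt = (P.tgt t : ℕ)

lemma AtStep.of_frame {lo : ℕ} (h : P.AtStep r t σ) (hτ : Frame lo σ τ)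
    (hlo : rVert ≤ lo := by simp) : P.AtStep r t τ where
  reg_rank := (hτ.reg _ (by simp; omega)).trans h.reg_rank
  reg_prev := (hτ.reg _ (by simp; omega)).trans h.reg_prev
  reg_src := (hτ.reg _ (by simp; omega)).trans h.reg_src
  reg_lab := (hτ.reg _ (by simp; omega)).trans h.reg_lab
  reg_tgt := (hτ.reg _ (by simp; omega)).trans h.reg_tgt

lemma relax_of_not_adj (h : ¬ P.G.Adj (P.lab t) u) :
    T.relax (stepCost P.M P.G P.wt) r (P.src t, P.lab t) (P.tgt t, u) = T := by
  simp [Table.relax, Table.lower, stepCost, h]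

lemma relax_of_dist_eq_top (h : T.dist (r, P.tgt t, u) = ⊤) :
    T.relax (stepCost P.M P.G P.wt) r (P.src t, P.lab t) (P.tgt t, u) = T := by
  simp [Table.relax, Table.lower, h]

lemma relax_of_dist_eq {z : ℤ} (huv : P.G.Adj (P.lab t) u) (h : T.dist (r, P.tgt t, u) = z) :
    T.relax (stepCost P.M P.G P.wt) r (P.src t, P.lab t) (P.tgt t, u) =
      T.lower (r + 1, P.src t, P.lab t) (P.wt (P.lab t) u + z : ℤ) (P.tgt t, u) := by
  simp [Table.relax, stepCost, huv, P.tgt_mem_step, h]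

lemma within_extendCmd (hσ : P.Loaded σ) (hT : P.Stores T σ.mem) (ht : P.AtStep r t σ)
    (hr : r < P.L) (hu : σ.reg rVert = (u : ℕ)) (hnext : σ.reg rNext = adr (r, P.tgt t, u))
    (huv : P.G.Adj (P.lab t) u) (hdist : T.dist (r, P.tgt t, u) ≠ ⊤) :
    Within P.w P.K extendCmd σ 18 (P.Reached rEntry σ
      (T.relax (stepCost P.M P.G P.wt) r (P.src t, P.lab t) (P.tgt t, u))) := by
  obtain ⟨z, hz⟩ := WithTop.ne_top_iff_exists.1 hdist
  rw [relax_of_dist_eq huv hz.symm]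
  have hwt := P.abs_wt_le _ _ huv
  have habs := hT.abs_le _ z hz.symm
  have hsum : |P.wt (P.lab t) u + z| ≤ (r + 1 : ℕ) * P.W := by
    refine (abs_add_le ..).trans ?_
    push_cast
    linarith
  have hfwt : P.Fits (P.wt (P.lab t) u) := fits_of_abs_le_rank (x := 1) (by omega) (by simpa)
  have hfz : P.Fits z := fits_of_abs_le_rank hr.le habs
  refine (within_posCmd hσ ht.reg_lab hu (by simp) ?_).seq
  refine (Within.load (by simp; rfl) (by exact hσ.wt _ _ huv) (fits_pos _ _) hfwt ?_).seq
  refine (Within.load (by simpa using hnext) (by exact hT.dist _ z hz.symm) (fits_adr hr.le) hfz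
    ?_).seq
  refine (Within.add (u := P.wt (P.lab t) u) (v := z) (by simp) (by simp) hfwt hfz
    (fits_of_abs_le_rank hr hsum) ?_).seq
  simp only [Store.setReg_setReg]
  have hframe (v v' : ℤ) : Frame rDist σ ((σ.setReg rTmp v).setReg rDist v') :=
    ((Store.AgreeOff.refl ..).setReg (by simp) _).setReg (by simp) _
  have hframe' (v v' v'' : ℤ) :
      Frame rEntry σ (((σ.setReg rTmp v).setReg rDist v').setReg rEntry v'') :=
    (((Store.AgreeOff.refl ..).setReg (by simp) _).setReg (by simp) _).setReg (by simp) _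
  refine (within_adrCmd (hσ.of_frame (hframe ..)) (p := (r + 1, P.src t, P.lab t)) hr
    (by simpa using ht.reg_rank) (by simpa using ht.reg_src) (by simpa using ht.reg_lab)
    (by simp) (by simp) (by simp) ?_).seq
  refine (within_improveCmd (hσ.of_frame (hframe' ..)) hT ?_).mono (by simp)
    fun τ hτ => .trans (hframe' ..) hτ (by simp)
  exact { reg_entry := by simp, reg_next := by simpa using hnext, reg_vert := by simpa using hu,
          reg_dist := by simp, le_L := hr, abs_le := hsum }

lemma within_followCmd (hσ : P.Loaded σ) (hT : P.Stores T σ.mem) (ht : P.AtStep r t σ)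
    (hr : r < P.L) (hu : σ.reg rVert = (u : ℕ)) (huv : P.G.Adj (P.lab t) u) :
    Within P.w P.K followCmd σ 24 (P.Reached rEntry σ
      (T.relax (stepCost P.M P.G P.wt) r (P.src t, P.lab t) (P.tgt t, u))) := by
  have hframe (v v' : ℤ) : Frame rEntry σ ((σ.setReg rNext v).setReg rTmp v') :=
    ((Store.AgreeOff.refl ..).setReg (by simp) _).setReg (by simp) _
  have hadr : P.Fits (adr (r, P.tgt t, u)) := fits_adr hr.le
  refine (within_adrCmd hσ (p := (r, P.tgt t, u)) hr.le ht.reg_prev ht.reg_tgt hu (by simp)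
    (by simp) (by simp) ?_).seq
  by_cases hdist : T.dist (r, P.tgt t, u) = ⊤
  · refine (Within.load (by simp) (by exact hT.unmarked _ hdist) hadr fits_zero ?_).seq
    refine .branch (T := 18) (by simp) fits_zero (absurd · (by simp)) fun _ => ?_
    rw [relax_of_dist_eq_top hdist]
    exact (Within.skip P.one_le_K ⟨hframe .., hT⟩).of_le (by simp)
  · refine (Within.load (by simp) (by exact hT.marked _ hdist) hadr fits_one ?_).seq
    refine .branch (T := 18) (by simp) fits_one (fun _ => ?_) (absurd · (by simp))
    have hτ := hframe (adr (r, P.tgt t, u)) 1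
    exact (within_extendCmd (hσ.of_frame hτ) hT (ht.of_frame hτ) hr
      (by simpa using hu) (by simp) huv hdist).imp fun υ hυ => .trans hτ hυ (by simp)

lemma within_relaxCmd (hσ : P.Loaded σ) (hT : P.Stores T σ.mem) (ht : P.AtStep r t σ)
    (hr : r < P.L) (hu : σ.reg rVert = (u : ℕ)) :
    Within P.w P.K relaxCmd σ 28 (P.Reached rEntry σ
      (T.relax (stepCost P.M P.G P.wt) r (P.src t, P.lab t) (P.tgt t, u))) := by
  have hframe (v : ℤ) : Frame rEntry σ (σ.setReg rTmp v) :=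
    (Store.AgreeOff.refl ..).setReg (by simp) _
  have hadj := hσ.adj (P.lab t) u
  refine (within_posCmd hσ ht.reg_lab hu (by simp) ?_).seq
  by_cases huv : P.G.Adj (P.lab t) u
  · rw [if_pos huv] at hadj
    refine (Within.load (by simp; rfl) (by exact hadj) (fits_pos _ _) fits_one ?_).seq
    refine .branch (T := 24) (by simp) fits_one (fun _ => ?_) (absurd · (by simp))
    rw [Store.setReg_setReg]
    exact (within_followCmd (hσ.of_frame (hframe 1)) hT (ht.of_frame (hframe 1)) hr
      (by simpa using hu) huv).imp fun υ hυ => .trans (hframe 1) hυ (by simp)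
  · rw [if_neg huv] at hadj
    refine (Within.load (by simp; rfl) (by exact hadj) (fits_pos _ _) fits_zero ?_).seq
    refine .branch (T := 24) (by simp) fits_zero (absurd · (by simp)) fun _ => ?_
    rw [Store.setReg_setReg, relax_of_not_adj huv]
    exact (Within.skip P.one_le_K ⟨hframe 0, hT⟩).of_le (by simp)

end Relax

section Layers

variable {n m : ℕ} {P : Problem n m} {σ : Store} {T : Table (Fin m × Fin n) (WithTop ℤ)}

/-- Relax all steps that read the transition `rTrans`. -/
def transitionCmd : Cmd :=
  fetchCmd ;; .forDown rZero rOne rVert rN relaxCmd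

/-- Handle the walks with `rLast - rLayer` steps. -/
def layerCmd : Cmd :=
  .arith .sub rRank rLast rLayer ;; .arith .sub rPrev rRank rOne ;;
    .forDown rZero rOne rTrans rD transitionCmd

/-- Compute the table of the cheapest walks. -/
def searchCmd : Cmd :=
  .forDown rZero rOne rTrans rD seedCmd ;; .forDown rZero rOne rLayer rLast layerCmd

lemma within_transitionCmd {r : ℕ} {t : Fin P.d} (hσ : P.Loaded σ) (hT : P.Stores T σ.mem)
    (hr : r < P.L) (ht : σ.reg rTrans = (t : ℕ)) (hrank : σ.reg rRank = (r + 1 : ℕ))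
    (hprev : σ.reg rPrev = r) :
    Within P.w P.K transitionCmd σ (34 * (n + 1)) (P.Reached rSrc σ
      (Fin.foldr n (fun u T => T.relax (stepCost P.M P.G P.wt) r (P.src t, P.lab t) (P.tgt t, u))
        T)) := by
  refine (within_fetchCmd hσ ht ?_).seq
  have hloaded := hσ.of_frame (frame_fetch t σ)
  have hstep : P.AtStep r t (P.fetch t σ) := by
    constructor <;> simp [fetch, hrank, hprev]
  refine (within_forDown (B := 28) (by simp) hloaded hT hloaded.reg_n (fits_natCast_of_lt P.n_lt)
    fun u T τ hτ hloaded hT hu => ?_).mono (by omega) fun τ hτ => .trans (frame_fetch t σ) hτ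
      (by simp)
  exact within_relaxCmd hloaded hT (hstep.of_frame hτ) hr hu

lemma within_layerCmd (hσ : P.Loaded σ) (hT : P.Stores T σ.mem) (i : Fin P.L)
    (hi : σ.reg rLayer = (i : ℕ)) :
    Within P.w P.K layerCmd σ (40 * ((P.d + 1) * (n + 1))) (P.Reached rRank σ
      (T.relaxLayer (stepCost P.M P.G P.wt) (fun t => (P.src t, P.lab t))
        (fun t u => (P.tgt t, u)) i.rev)) := by
  have hrank : (P.L : ℤ) - (i : ℕ) = (i.rev + 1 : ℕ) := by rw [Fin.val_rev]; omega
  have hprev : ((i.rev + 1 : ℕ) : ℤ) - 1 = (i.rev : ℕ) := by simp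
  have hN : P.d + 1 ≤ (P.d + 1) * (n + 1) := Nat.le_mul_of_pos_right _ n.succ_pos
  have hframe (u v : ℤ) : Frame rRank σ ((σ.setReg rRank u).setReg rPrev v) :=
    ((Store.AgreeOff.refl ..).setReg (by simp) _).setReg (by simp) _
  refine (Within.sub hσ.reg_last hi (fits_length le_rfl) (fits_length i.2.le)
    (hrank ▸ fits_length i.rev.2) ?_).seq (by omega)
  rw [hrank]
  refine (Within.sub (by simp) (by simpa using hσ.reg_one) (fits_length i.rev.2) fits_one
    (hprev ▸ fits_length i.rev.2.le) ?_).seq (by omega)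
  rw [hprev]
  have hloaded := hσ.of_frame (hframe (i.rev + 1 : ℕ) (i.rev : ℕ))
  refine (within_forDown (B := 34 * (n + 1)) (by simp) hloaded hT hloaded.reg_d
    (fits_natCast_of_lt P.d_lt) fun t T τ hτ hloaded hT ht => ?_).mono
      (Nat.le_sub_of_add_le (Nat.le_sub_of_add_le (by nlinarith)))
      fun τ hτ => .trans (hframe ..) hτ (by simp)
  exact within_transitionCmd hloaded hT i.rev.2 ht ((hτ.reg _ (by simp)).trans (by simp))
    ((hτ.reg _ (by simp)).trans (by simp))

lemma within_searchCmd (hσ : P.Loaded σ) (hT : P.Stores .empty σ.mem) :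
    Within P.w P.K searchCmd σ (71 * ((P.L + 1) * ((P.d + 1) * (n + 1))))
      (P.Reached rLayer σ P.table) := by
  classical
  have hN : P.d + 1 ≤ (P.d + 1) * (n + 1) := Nat.le_mul_of_pos_right _ n.succ_pos
  have hLN : P.L + 1 ≤ (P.L + 1) * ((P.d + 1) * (n + 1)) :=
    Nat.le_mul_of_pos_right _ (by positivity)
  have hNL : (P.d + 1) * (n + 1) ≤ (P.L + 1) * ((P.d + 1) * (n + 1)) :=
    Nat.le_mul_of_pos_left _ P.L.succ_pos
  have hseed : Within P.w P.K (.forDown rZero rOne rTrans rD seedCmd) σ (1 + (P.d + 1) * 27)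
      (P.Reached rTrans σ P.seedTable) := by
    refine (within_forDown (by simp) hσ hT hσ.reg_d (fits_natCast_of_lt P.d_lt)
      fun t T τ _ hloaded hT ht => within_seedCmd hloaded hT ht).imp fun τ hτ => ?_
    unfold seedTable Table.seed
    convert hτ
  refine (hseed.imp fun τ hτ => ?_).seq (by omega)
  have hloaded := hσ.of_frame hτ.frame
  refine (within_forDown (by simp) hloaded hτ.stores hloaded.reg_last (fits_length le_rfl)
    fun i T τ _ hloaded hT hi => within_layerCmd hloaded hT i hi).mono
      (Nat.le_sub_of_add_le (by nlinarith)) fun υ hυ => ?_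
  exact .trans (hτ.frame.mono (Set.Ico_subset_Ico_left (by simp)) subset_rfl) hυ (by simp)

end Layers

section Answer

variable {n m : ℕ} {P : Problem n m} {σ : Store} {T : Table (Fin m × Fin n) (WithTop ℤ)}

/-- Move on to the next node of the recorded walk and append its vertex to the answer. -/
def nextCmd : Cmd :=
  .load rVert bVert rEntry ;; .load rEntry bNext rEntry ;; .arith .add rRank rRank rOne ;;
    .store bAdj rRank rVert

/-- Write down the recorded walk from the entry `rEntry`. -/
def traceCmd : Cmd :=
  .store bAdj rZero rA ;; .arith .add rRank rZero rZero ;; .forDown rZero rOne rLayer rLast nextCmd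

/-- Read the answer off the table. -/
def answerCmd : Cmd :=
  adrCmd rEntry rLast rStart rA ;; .load rTmp bMark rEntry ;;
    .branch rTmp (traceCmd ;; .const rN 1) (.const rN 0)

lemma Stores.setMem_zero (h : P.Stores T σ.mem) (y z : ℤ) : P.Stores T (σ.setMem 0 y z).mem := by
  exact ⟨h.unmarked, h.marked, h.dist, h.next, h.vert, h.abs_le⟩

lemma dist_next_ne_top {r : ℕ} {x : Fin m × Fin n} (hx : P.table.dist (r + 1, x) ≠ ⊤) :
    P.table.dist (r, P.table.next (r + 1, x)) ≠ ⊤ :=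
  (WithTop.add_ne_top.1 (ne_top_of_le_ne_top hx (P.isExact_table.step_le r x))).2

/-- From the cell `i` on, the bank lists the vertices of `l`. -/
def Lists (i : ℕ) (l : List (Fin n)) (bank : ℤ → ℤ) : Prop :=
  ∀ j : Fin l.length, bank (i + j : ℕ) = (l.get j : ℕ)

lemma lists_cons {i : ℕ} {v : Fin n} {l : List (Fin n)} {bank : ℤ → ℤ} (hv : bank i = (v : ℕ))
    (hl : Lists (i + 1) l bank) : Lists i (v :: l) bank := by
  intro j
  cases j using Fin.cases with
  | zero => simpa using hv
  | succ j => simpa [add_assoc, add_left_comm, add_comm] using hl j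

lemma within_nextCmd_loop (hT : P.Stores P.table σ.mem) (hone : σ.reg rOne = 1) {r i : ℕ}
    {x : Fin m × Fin n} (hir : i + r = P.L) (hr : σ.reg rLayer = r) (hi : σ.reg rRank = i)
    (hentry : σ.reg rEntry = adr (r, x)) (hx : P.table.dist (r, x) ≠ ⊤)
    (hmem : σ.mem bAdj i = (x.2 : ℕ)) :
    Within P.w P.K (.loop rLayer (.seq (.arith .sub rLayer rLayer rOne) nextCmd)) σ (6 * r + 1)
      fun τ => (∀ y ≤ (i : ℤ), τ.mem bAdj y = σ.mem bAdj y) ∧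
        Lists i (x.2 :: (P.table.trace r x).map Prod.snd) (τ.mem bAdj) := by
  induction r generalizing σ i x with
  | zero =>
    exact (Within.loop_zero hr fits_zero ⟨fun _ _ => rfl, lists_cons hmem fun j => j.elim0⟩)
  | succ r ih =>
    have hnext := dist_next_ne_top hx
    generalize hy : P.table.next (r + 1, x) = y at hnext
    have hfits : P.Fits (i + 1 : ℕ) := fits_length (by omega)
    refine Within.loop_succ (T' := 4) hr hone (fun j hj => fits_length (by omega)) ?_ (by omega)
    refine (Within.load (by simpa using hentry) (by exact hT.vert _ hx) (fits_adr (by simp; omega))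
      (fits_vertex _) ?_).seq
    refine (Within.load (v := adr (r, y)) (by simpa using hentry)
      (by simpa [hy] using hT.next _ hx) (fits_adr (by simp; omega)) (fits_adr (by simp; omega))
      ?_).seq
    refine (Within.add (u := i) (v := 1) (by simpa using hi) (by simpa using hone)
      (fits_length (by omega)) fits_one (by exact_mod_cast hfits) ?_).seq
    refine Within.store (u := (i + 1 : ℕ)) (v := (y.2 : ℕ)) (by simp) (by simp [hy]) hfits
      (fits_vertex _) ?_
    rw [show 6 * (r + 1) + 1 - (4 + 2) = 6 * r + 1 by omega]
    refine (ih (i := i + 1) ?_ ?_ (by omega) ?_ ?_ ?_ hnext ?_).imp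
      fun τ hτ => ⟨fun z hz => ?_, ?_⟩
    · exact Stores.setMem_zero (by exact hT) ..
    · simpa using hone
    · simp
    · simp
    · simp
    · simp
    · rw [hτ.1 z (by push_cast; omega)]
      exact Function.update_of_ne (by push_cast; omega) ..
    · rw [Table.trace, hy]
      refine lists_cons ?_ hτ.2
      rw [hτ.1 i (by simp)]
      simpa using hmem

lemma within_traceCmd (hσ : P.Loaded σ) (hT : P.Stores P.table σ.mem)
    (hentry : σ.reg rEntry = adr (P.L, P.q₀, P.a)) (hd : P.table.dist (P.L, P.q₀, P.a) ≠ ⊤) :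
    Within P.w P.K traceCmd σ (6 * P.L + 4) fun τ =>
      Lists 0 (P.a :: (P.table.trace P.L (P.q₀, P.a)).map Prod.snd) (τ.mem bAdj) := by
  refine (Within.store hσ.reg_zero hσ.reg_a fits_zero (fits_vertex _) ?_).seq
  refine (Within.add (by simpa using hσ.reg_zero) (by simpa using hσ.reg_zero) fits_zero fits_zero
    (by simpa using fits_zero) ?_).seq
  refine (Within.add (by simpa using hσ.reg_last) (by simpa using hσ.reg_zero)
    (fits_length le_rfl) fits_zero (by simpa using fits_length le_rfl) ?_).seq
  refine (within_nextCmd_loop (x := (P.q₀, P.a)) (i := 0) (r := P.L) ?_ ?_ (by simp) ?_ ?_ ?_ hd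
    ?_).mono (by omega) fun τ hτ => hτ.2
  · exact Stores.setMem_zero (by exact hT) ..
  · simpa using hσ.reg_one
  · simp
  · simp
  · simpa using hentry
  · simp

lemma within_answerCmd (hσ : P.Loaded σ) (hT : P.Stores P.table σ.mem) :
    Within P.w P.K answerCmd σ (6 * P.L + 11) (IsAnswer P.G P.wt (P.L + 1) P.a P.b) := by
  have hloaded (z : ℤ) : P.Loaded (σ.setReg rEntry z) := hσ.setReg (by simp) z
  refine (within_adrCmd hσ (p := (P.L, P.q₀, P.a)) le_rfl hσ.reg_last hσ.reg_start hσ.reg_a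
    (by simp) (by simp) (by simp) ?_).seq
  by_cases hd : P.table.dist (P.L, P.q₀, P.a) = ⊤
  · refine (Within.load (by simp; rfl) (by exact hT.unmarked _ hd) (fits_adr le_rfl) fits_zero
      ?_).seq
    refine (Within.branch (T := 1) (by simp) fits_zero (absurd · (by simp)) fun _ =>
      Within.const fits_zero ?_).of_le (by omega)
    exact .inr ⟨by simp, fun ⟨p, hp⟩ =>
      not_isSimplePath_of_dist_eq_top P.accepts_eq P.start_eq P.isExact_table hd p hp⟩
  · refine (Within.load (by simp; rfl) (by exact hT.marked _ hd) (fits_adr le_rfl) fits_one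
      ?_).seq
    refine (Within.branch (T := 6 * P.L + 5) (by simp) fits_one (fun _ => ?_)
      (absurd · (by simp))).of_le (by omega)
    refine ((within_traceCmd ((hloaded _).setReg (by simp) _) (by exact hT) (by simp) hd).imp
      fun τ hτ => ?_).seq
    refine (Within.const fits_one ?_).of_le (by omega)
    refine .inl ⟨by simp, _,
      isMinSimplePath_of_dist_ne_top P.accepts_eq P.start_eq P.isExact_table hd, fun i => ?_⟩
    simpa using hτ i

end Answer

section Solve

variable {n m : ℕ} {P : Problem n m} {τ : Store}

/-- Solve the path problem, with the automaton that `A` constructs in the registers from 32 on and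
the banks from 8 on. -/
def solveCmd (A : Cmd) : Cmd :=
  .const rOne 1 ;; .arith .add rM rN rZero ;; .arith .add rD rK rZero ;; A.shift 32 8 ;;
    .arith .sub rLast rK rOne ;; searchCmd ;; answerCmd

open Classical in
/-- The store holds the automaton of the problem, with the transitions listed by `P.e`, in the
layout of `KPath.Holds`. -/
structure HoldsAutomaton (P : Problem n m) (τ : Store) : Prop where
  reg_m : τ.reg 0 = m
  reg_d : τ.reg 1 = P.d
  reg_start : τ.reg 2 = (P.q₀ : ℕ)
  src : ∀ t : Fin P.d, τ.mem 0 (t : ℕ) = (P.src t : ℕ)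
  lab : ∀ t : Fin P.d, τ.mem 1 (t : ℕ) = (P.lab t : ℕ)
  tgt : ∀ t : Fin P.d, τ.mem 2 (t : ℕ) = (P.tgt t : ℕ)
  acc : ∀ q : Fin m, τ.mem 3 (q : ℕ) = if q ∈ P.M.accept then 1 else 0

/-- The store in which the construction of the automaton starts. -/
noncomputable def callStore (P : Problem n m) : Store :=
  (((pathInput P.G P.wt (P.L + 1) P.a P.b).setReg rOne 1).setReg rM n).setReg rD (P.L + 1 : ℕ)

lemma view_callStore (P : Problem n m) : P.callStore.view 32 8 = paramInput n (P.L + 1) := by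
  simp only [Store.view, paramInput, Store.mk.injEq]
  constructor
  · funext r
    rcases r with - | - | r <;> simp [callStore, pathInput]
  · rfl

lemma sum_sum_pos (p : Fin n → Fin n → Prop) [∀ u v, Decidable (p u v)]
    (f : Fin n → Fin n → ℤ) (u v : Fin n) :
    (∑ u' : Fin n, ∑ v' : Fin n,
      if pos u v = (u' : ℕ) * (n : ℤ) + (v' : ℕ) ∧ p u' v' then f u' v' else 0) =
      if p u v then f u v else 0 := by
  have hpos (u' v' : Fin n) : pos u v = (u' : ℕ) * (n : ℤ) + (v' : ℕ) ↔ u' = u ∧ v' = v := by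
    constructor
    · intro h
      rw [pos] at h
      obtain ⟨hu, hv⟩ := mul_add_inj (i := u) (i' := u') (j := v) (j' := v') (by exact_mod_cast h)
      exact ⟨Fin.ext hu.symm, hv.symm⟩
    · rintro ⟨rfl, rfl⟩
      simp [pos]
  simp [hpos, and_assoc, ite_and]

lemma stores_empty (h : ∀ b ∈ Set.Ico 2 8, τ.mem b = 0) : P.Stores .empty τ.mem where
  unmarked x _ := congrFun (h bMark (by simp)) _
  marked x hx := absurd rfl hx
  dist x z hz := absurd hz (by simp [Table.empty])
  next x hx := absurd rfl hx
  vert x hx := absurd rfl hx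
  abs_le x z hz := absurd hz (by simp [Table.empty])

lemma loaded_of_agreeOff (h : P.callStore.AgreeOff (Set.Ici 32) (Set.Ici 8) τ)
    (hτ : P.HoldsAutomaton (τ.view 32 8)) : P.Loaded (τ.setReg rLast P.L) where
  reg_n := by simp [h.reg, callStore, pathInput]
  reg_a := by simp [h.reg, callStore, pathInput]
  reg_b := by simp [h.reg, callStore, pathInput]
  reg_zero := by simp [h.reg, callStore, pathInput]
  reg_one := by simp [h.reg, callStore, pathInput]
  reg_last := by simp
  reg_m := hτ.reg_m
  reg_d := hτ.reg_d
  reg_start := hτ.reg_start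
  adj u v := by
    classical
    rw [Store.mem_setReg, h.mem _ (by simp)]
    exact sum_sum_pos P.G.Adj (fun _ _ => 1) u v
  wt u v huv := by
    classical
    rw [Store.mem_setReg, h.mem _ (by simp)]
    exact (sum_sum_pos P.G.Adj P.wt u v).trans (if_pos huv)
  src := hτ.src
  lab := hτ.lab
  tgt := hτ.tgt
  acc := hτ.acc

lemma within_solveCmd {A : Cmd} {t : ℕ} (hA : Exec P.w A (paramInput n (P.L + 1)) τ t)
    (hτ : P.HoldsAutomaton τ) :
    Within P.w P.K (solveCmd A) (pathInput P.G P.wt (P.L + 1) P.a P.b)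
      (t + (71 * ((P.L + 1) * ((P.d + 1) * (n + 1))) + 6 * P.L + 15))
      (IsAnswer P.G P.wt (P.L + 1) P.a P.b) := by
  have hn := fits_natCast_of_lt P.n_lt
  have hk : P.Fits (P.L + 1 : ℕ) := fits_natCast_of_lt (Nat.lt_of_le_of_lt P.L_lt P.n_lt)
  obtain ⟨υ, hshift, rfl, hυ⟩ := hA.shift 32 8 P.callStore P.view_callStore
  have hloaded := loaded_of_agreeOff hυ hτ
  have hempty : P.Stores .empty (υ.setReg rLast P.L).mem := stores_empty fun b hb => by
    rw [Store.mem_setReg, hυ.mem b (by simpa using hb.2)]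
    obtain ⟨h, -⟩ := hb
    funext x
    match b, h with
    | b + 2, _ => rfl
  refine (Within.const fits_one ?_).seq
  refine (Within.add (u := n) (v := 0) (by simp [pathInput]) (by simp [pathInput]) hn fits_zero
    (by simpa using hn) ?_).seq
  refine (Within.add (u := (P.L + 1 : ℕ)) (v := 0) (by simp [pathInput]) (by simp [pathInput]) hk
    fits_zero (by simpa using hk) ?_).seq
  simp only [add_zero]
  refine Within.seq (T' := t) ⟨υ, t, hshift, Nat.le_mul_of_pos_right _ P.one_le_K, ?_⟩
  refine (Within.sub (u := (P.L + 1 : ℕ)) (v := 1) ?_ ?_ hk fits_one ?_ ?_).seq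
  · simp [hυ.reg, callStore, pathInput]
  · simp [hυ.reg, callStore, pathInput]
  · simpa using fits_length le_rfl
  rw [Nat.cast_add_one, add_sub_cancel_right]
  refine ((within_searchCmd hloaded hempty).imp fun ω hω => ?_).seq
  exact (within_answerCmd (hloaded.of_frame hω.frame) hω.stores).of_le (by omega)

lemma K_le_log (hW : 2 ≤ P.W) : (P.K : ℝ) ≤ 27 * Real.log P.W := by
  have hlog2 := Real.log_two_gt_d9
  have hsize : Nat.size P.W ≤ Nat.log 2 P.W + 1 :=
    Nat.size_le.2 (Nat.lt_pow_succ_log_self one_lt_two _)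
  have hpow : (Nat.log 2 P.W : ℝ) * Real.log 2 ≤ Real.log P.W := by
    rw [← Real.log_pow]
    exact Real.log_le_log (by positivity) (by exact_mod_cast Nat.pow_log_le_self 2 (by omega))
  have hlogW : Real.log 2 ≤ Real.log P.W := Real.log_le_log two_pos (by exact_mod_cast hW)
  calc (P.K : ℝ) ≤ 3 * (4 + (Nat.log 2 P.W + 1)) := by
        exact_mod_cast Nat.mul_le_mul_left 3 (Nat.add_le_add_left hsize 4)
    _ ≤ 27 * Real.log P.W := by nlinarith [(Nat.log 2 P.W).cast_nonneg (α := ℝ)]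

lemma search_rounds_le {s : ℕ} (hs : m + P.d = s) :
    71 * ((P.L + 1) * ((P.d + 1) * (n + 1))) + 6 * P.L + 15 ≤ 163 * (s * n ^ 2) := by
  have hL := P.L_lt
  have hds : P.d + 1 ≤ s := by have := P.q₀.pos; omega
  have hn : n ≤ s * n ^ 2 := by nlinarith
  have h : (P.L + 1) * ((P.d + 1) * (n + 1)) ≤ n * (s * (2 * n)) := by
    gcongr <;> omega
  linarith

end Solve

end Problem

section Size

lemma exists_nodup_cons {n k : ℕ} (hk : 1 ≤ k) (hkn : k ≤ n) (v : Fin n) :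
    ∃ p, v :: p ∈ distinctWords n k := by
  obtain ⟨s, hvs, -, hs⟩ := Finset.exists_subsuperset_card_eq (Finset.subset_univ {v})
    (by simpa using hk) (by simpa using hkn)
  refine ⟨(s.erase v).toList, ?_, ?_⟩
  · rw [List.length_cons, Finset.length_toList]
    rw [Finset.singleton_subset_iff] at hvs
    rw [Finset.card_erase_add_one hvs, hs]
  · simp [Finset.nodup_toList]

lemma exists_mem_step {n k : ℕ} {Q : Type*} {M : NFA (Fin n) Q} (hk : 1 ≤ k) (hkn : k ≤ n)
    (hL : M.accepts = distinctWords n k) (v : Fin n) : ∃ q q', q' ∈ M.step q v := by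
  obtain ⟨p, hp⟩ := exists_nodup_cons hk hkn v
  rw [← hL, NFA.accepts_eq_acceptsFrom_start, NFA.cons_mem_acceptsFrom] at hp
  obtain ⟨_, -, hp⟩ := hp
  obtain ⟨q', hq', -⟩ := (NFA.mem_evalFrom_iff_exists ..).1 hp
  obtain ⟨q, -, hq⟩ := (NFA.mem_stepSet ..).1 hq'
  exact ⟨q, q', hq⟩

lemma lt_autSize {n k : ℕ} {Q : Type*} [Finite Q] {M : NFA (Fin n) Q} (hk : 1 ≤ k) (hkn : k ≤ n)
    (hL : M.accepts = distinctWords n k) : n < autSize M := by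
  have himage : (fun e => e.2.1) '' transitions M = Set.univ := by
    refine Set.eq_univ_of_forall fun v => ?_
    obtain ⟨q, q', h⟩ := exists_mem_step hk hkn hL v
    exact ⟨(q, v, q'), h, rfl⟩
  have hcard : n ≤ (transitions M).ncard := by
    calc n = ((fun e => e.2.1) '' transitions M).ncard := by simp [himage, Set.ncard_univ]
      _ ≤ _ := Set.ncard_image_le
  obtain ⟨q, -⟩ := exists_mem_step hk hkn hL ⟨0, hk.trans hkn⟩
  have : Nonempty Q := ⟨q⟩
  have := Nat.card_pos (α := Q)
  rw [autSize]
  omega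

lemma autSize_eq {n m d : ℕ} {M : NFA (Fin n) (Fin m)} (e : Fin d ≃ transitions M) :
    autSize M = m + d := by
  rw [autSize, ← Nat.card_coe_set_eq, ← Nat.card_congr e, Nat.card_fin, Nat.card_fin]

end Size

section SolvesWithin

variable {n m k w : ℕ} {M : NFA (Fin n) (Fin m)} {A : Cmd} {G : Digraph (Fin n)}
  {wt : Fin n → Fin n → ℤ} {a b : Fin n}

lemma exists_problem {τ : Store} {L W : ℕ} (hL : L < n) (hM : M.accepts = distinctWords n (L + 1))
    (hw : Nat.size (autSize M) ≤ w) (hτ : Holds τ M) (hW : 1 ≤ W)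
    (hwt : ∀ u v, G.Adj u v → |wt u v| ≤ W) (a b : Fin n) :
    ∃ P : Problem n m, (P.G = G ∧ P.wt = wt ∧ P.L = L ∧ P.a = a ∧ P.b = b) ∧ P.w = w ∧ P.W = W ∧
      m + P.d = autSize M ∧ P.HoldsAutomaton τ := by
  obtain ⟨q₀, d, e, hstart, hm, hd, hq₀, htrans, hacc⟩ := hτ
  have hlt : autSize M < 2 ^ w := Nat.size_le.1 hw
  have hn : n < autSize M := lt_autSize L.succ_pos hL hM
  have hsize := autSize_eq e
  exact ⟨{
    G, wt, a, b, L, M, q₀, d, w, W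
    e := fun t => (e t).1
    accepts_eq := hM
    start_eq := hstart
    range_e := by rw [← Function.comp_def, e.surjective.range_comp, Subtype.range_coe]
    L_lt := hL
    n_lt := by omega
    m_lt := by omega
    d_lt := by omega
    one_le_W := hW
    abs_wt_le := hwt }, ⟨rfl, rfl, rfl, rfl, rfl⟩, rfl, rfl, hsize.symm,
    { reg_m := hm
      reg_d := hd
      reg_start := hq₀
      src := fun t => (htrans t).1
      lab := fun t => (htrans t).2.1
      tgt := fun t => (htrans t).2.2
      acc := hacc }⟩

lemma solvesWithin_solveCmd {C : ℝ} (hk : 1 ≤ k) (hkn : k ≤ n)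
    (hM : M.accepts = distinctWords n k) (hw : Nat.size (autSize M) ≤ w)
    (hA : ConstructsWithin w A k M (C * autSize M)) {W : ℕ} (hW : 2 ≤ W)
    (hwt : ∀ u v, G.Adj u v → -(W : ℤ) ≤ wt u v ∧ wt u v ≤ W) :
    SolvesWithin w (Problem.solveCmd A) G wt k a b
      (27 * (|C| + 163) * (autSize M * (n : ℝ) ^ 2 * Real.log W)) := by
  obtain ⟨τ, t, hexec, hτ, ht⟩ := hA
  obtain ⟨L, rfl⟩ : ∃ L, k = L + 1 := Nat.exists_eq_add_of_le' hk
  obtain ⟨P, ⟨rfl, rfl, rfl, rfl, rfl⟩, rfl, rfl, hd, hP⟩ :=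
    exists_problem hkn hM hw hτ (by omega) (fun u v h => abs_le.2 (hwt u v h)) a b
  obtain ⟨υ, t', hsolve, ht', hans⟩ := Problem.within_solveCmd hexec hP
  refine ⟨υ, t', hsolve, hans, ?_⟩
  set s : ℝ := autSize M * (n : ℝ) ^ 2 with hs
  have hrounds := Problem.search_rounds_le hd
  have ht : (t : ℝ) ≤ |C| * s := by
    calc (t : ℝ) ≤ |C| * autSize M := ht.trans (by gcongr; exact le_abs_self C)
      _ ≤ |C| * s := by
        gcongr
        exact le_mul_of_one_le_right (by positivity)
          (one_le_pow₀ (by exact_mod_cast hk.trans hkn))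
  calc (t' : ℝ) ≤ (t + 163 * s) * P.K := by
        rw [hs]
        exact_mod_cast ht'.trans (Nat.mul_le_mul_right _ (Nat.add_le_add_left hrounds t))
    _ ≤ (|C| * s + 163 * s) * (27 * Real.log P.W) := by
        gcongr
        exact Problem.K_le_log hW
    _ = _ := by ring

lemma SolvesWithin.mul_log {s : ℕ} {D x y : ℝ} (hs : 2 ≤ s) (hx : 0 ≤ s * x * y)
    (h : SolvesWithin w A G wt k a b (D * (s * x * y))) :
    SolvesWithin w A G wt k a b (2 * |D| * (s * Real.log s * x * y)) := by
  obtain ⟨τ, t, hA, hτ, ht⟩ := h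
  refine ⟨τ, t, hA, hτ, ht.trans ?_⟩
  have hlog : 1 ≤ 2 * Real.log s := by
    have := Real.log_le_log two_pos (Nat.ofNat_le_cast.2 hs)
    linarith [Real.log_two_gt_d9]
  calc D * (s * x * y) ≤ |D| * (s * x * y) * (2 * Real.log s) :=
        (mul_le_mul_of_nonneg_right (le_abs_self D) hx).trans
          (le_mul_of_one_le_right (by positivity) hlog)
    _ = _ := by ring

end SolvesWithin

end KPath

theorem theorem1_general (P : WordRAM.Cmd) :
    ∃ A : WordRAM.Cmd, ∀ C : ℝ, ∃ D : ℝ, ∀ (n k m w : ℕ) (M : NFA (Fin n) (Fin m)),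
      1 ≤ k → k ≤ n →
      M.accepts = KPath.distinctWords n k →
      Nat.size (KPath.autSize M) ≤ w →
      KPath.ConstructsWithin w P k M (C * KPath.autSize M) →
      ∀ (G : Digraph (Fin n)) (wt : Fin n → Fin n → ℤ) (a b : Fin n) (W : ℕ),
        2 ≤ W →
        (∀ u v, G.Adj u v → -(W : ℤ) ≤ wt u v ∧ wt u v ≤ W) →
        KPath.SolvesWithin w A G wt k a b (D * (KPath.autSize M * (n : ℝ) ^ 2 * Real.log W)) :=
  ⟨KPath.Problem.solveCmd P, fun C => ⟨27 * (|C| + 163), fun _ _ _ _ _ hk hkn hM hw hP _ _ _ _ _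
    hW hwt => KPath.solvesWithin_solveCmd hk hkn hM hw hP hW hwt⟩⟩

theorem theorem1 (P : WordRAM.Cmd) :
    (∃ A : WordRAM.Cmd, ∀ C : ℝ, ∃ D : ℝ,
      ∀ (n k m w : ℕ) (M : NFA (Fin n) (Fin m)),
        1 ≤ k → k ≤ n →
        M.accepts = KPath.distinctWords n k →
        Nat.size (KPath.autSize M) ≤ w →
        KPath.ConstructsWithin w P k M (C * KPath.autSize M) →
        ∀ (G : Digraph (Fin n)) (wt : Fin n → Fin n → ℤ) (a b : Fin n) (W : ℕ),
          2 ≤ W →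
          (∀ u v, G.Adj u v → 0 ≤ wt u v ∧ wt u v ≤ W) →
          KPath.SolvesWithin w A G wt k a b
            (D * (KPath.autSize M * Real.log (KPath.autSize M) * (n : ℝ) ^ 2 * Real.log W))) ∧
    (∃ A : WordRAM.Cmd, ∀ C : ℝ, ∃ D : ℝ,
      ∀ (n k m w : ℕ) (M : NFA (Fin n) (Fin m)),
        1 ≤ k → k ≤ n →
        M.accepts = KPath.distinctWords n k →
        KPath.IsAcyclic M →
        Nat.size (KPath.autSize M) ≤ w →
        KPath.ConstructsWithin w P k M (C * KPath.autSize M) →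
        ∀ (G : Digraph (Fin n)) (wt : Fin n → Fin n → ℤ) (a b : Fin n) (W : ℕ),
          2 ≤ W →
          (∀ u v, G.Adj u v → -(W : ℤ) ≤ wt u v ∧ wt u v ≤ W) →
          KPath.SolvesWithin w A G wt k a b
            (D * (KPath.autSize M * (n : ℝ) ^ 2 * Real.log W))) := by
  obtain ⟨A, hA⟩ := theorem1_general P
  choose D hD using hA
  refine ⟨⟨A, fun C => ⟨2 * |D C|, ?_⟩⟩, A, fun C => ⟨D C, ?_⟩⟩
  · intro n k m w M hk hkn hM hw hP G wt a b W hW hwt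
    refine (hD C n k m w M hk hkn hM hw hP G wt a b W hW fun u v h => ?_).mul_log ?_ (by positivity)
    · exact ⟨(neg_nonpos.2 W.cast_nonneg).trans (hwt u v h).1, (hwt u v h).2⟩
    · exact (Nat.succ_le_succ (hk.trans hkn)).trans (KPath.lt_autSize hk hkn hM)
  · exact fun n k m w M hk hkn hM _ => hD C n k m w M hk hkn hM
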